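/- Let $\Lambda$ be an artin algebra (a ring that is an algebra over, and a finitely generated module over, some commutative artinian ring), let $\mathrm{mod}\,\Lambda$ be the category of finitely generated left $\Lambda$-modules, let $P$ be a finitely generated projective $\Lambda$-module, and let $\Gamma=\mathrm{End}_\Lambda(P)^{op}$. For $M$ in $\mathrm{mod}\,\Lambda$, $\mathrm{Hom}_\Lambda(P,M)$ is a finitely generated left $\Gamma$-module by precomposition, and $\Gamma$ is again an artin algebra. The following notions are used for both algebras. For a module $M$, $\mathrm{add}\,M$ is the class of direct summands of finite direct sums of copies of $M$. For $d\in\mathbb N=\{0,1,2,\dots\}$, a pair $(X_1,X_2)$ of modules in $\mathrm{add}\,M$ is a *$d$-division* of $M$ if $\mathrm{add}\,X_1\cap\mathrm{add}\,X_2=0$, $\mathrm{Ext}^d_\Lambda(X_1,-)\not\simeq\mathrm{Ext}^d_\Lambda(X_2,-)$ and $\mathrm{Ext}^{d+1}_\Lambda(X_1,-)\simeq\mathrm{Ext}^{d+1}_\Lambda(X_2,-)$ as functors on $\mathrm{mod}\,\Lambda$. Let $\Omega(M)$ be the kernel of the projective cover of $M$. Let $K_0$ be the abelian group generated by the symbols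 $[M]$, $M$ in $\mathrm{mod}\,\Lambda$, modulo $[C]=[A]+[B]$ if $C\simeq A\oplus B$ and $[Q]=0$ if $Q$ is projective; write $\Omega:K_0\to K_0$ also for the endomorphism $[M]\mapsto[\Omega(M)]$, and $\langle\mathrm{add}\,M\rangle\subseteq K_0$ for the subgroup generated by the classes of the indecomposable direct summands of $M$. Then $\phi_l^\Lambda(M)$ is the smallest integer $n\ge 0$ such that $\Omega:\Omega^s(\langle\mathrm{add}\,M\rangle)\to\Omega^{s+1}(\langle\mathrm{add}\,M\rangle)$ is an isomorphism for all $s\ge n$, and $$\psi_l^\Lambda(M)=\phi_l^\Lambda(M)+\sup\{\mathrm{pd}\,X : X \text{ a nonzero direct summand of } \Omega^{\phi_l^\Lambda(M)}(M),\ \mathrm{pd}\,X<\infty\},$$ with $\sup\emptyset=0$. Let $Y$ be in $\mathrm{mod}\,\Lambda$ and suppose that $Y$ has a projective resolution $\cdots\to P_1\to P_0\to Y\to 0$ with $P_i\in\mathrm{add}\,P$ for all $i\ge 0$ (that is, $Y\in\mathbb P_\infty$). Then: (a) for every $d\in\mathbb N$, there is a $d$-division of $Y$ if and only if there is a $d$-division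 of the $\Gamma$-module $\mathrm{Hom}_\Lambda(P,Y)$; (b) $\phi_l^\Lambda(Y)=\phi_l^\Gamma(\mathrm{Hom}_\Lambda(P,Y))$; (c) $\psi_l^\Lambda(Y)=\psi_l^\Gamma(\mathrm{Hom}_\Lambda(P,Y))$. -/

import Mathlib

open CategoryTheory

universe u

namespace IgusaTodorov

noncomputable section

/-- An artin algebra: a ring that is a finitely generated module over some commutative artinian
ring `R` by which it is an algebra. -/
class IsArtinAlgebra (Λ : Type u) [Ring Λ] : Prop where
  exists_base : ∃ (R : Type u) (_ : CommRing R) (_ : IsArtinianRing R) (_ : Algebra R Λ),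
    Module.Finite R Λ

instance IsArtinAlgebra.isArtinianRing (Λ : Type u) [Ring Λ] [h : IsArtinAlgebra Λ] :
    IsArtinianRing Λ := by
  obtain ⟨R, _, _, _, _⟩ := h.exists_base
  exact isArtinian_of_tower R inferInstance

section Modules

variable {Λ : Type u} [Ring Λ]

/-- `X` is (isomorphic to) a direct summand of `M`. -/
def IsSummand (X M : Type u) [AddCommGroup X] [Module Λ X] [AddCommGroup M] [Module Λ M] : Prop :=
  ∃ (i : X →ₗ[Λ] M) (p : M →ₗ[Λ] X), p ∘ₗ i = LinearMap.id

/-- `X` belongs to `add M`: it is a direct summand of a finite direct sum of copies of `M`. -/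
def InAdd (M X : Type u) [AddCommGroup M] [Module Λ M] [AddCommGroup X] [Module Λ X] : Prop :=
  ∃ n : ℕ, IsSummand (Λ := Λ) X (Fin n → M)

/-- A nonzero module which is not the direct sum of two nonzero submodules. -/
def IsIndecomposable (X : Type u) [AddCommGroup X] [Module Λ X] : Prop :=
  Nontrivial X ∧ ∀ A B : Submodule Λ X, IsCompl A B → A = ⊥ ∨ B = ⊥

/-- `f : Q → M` is a projective cover: `Q` is projective, `f` is surjective, and the kernel of `f`
is superfluous. -/
structure IsProjectiveCover {Q M : Type u} [AddCommGroup Q] [Module Λ Q]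
    [AddCommGroup M] [Module Λ M] (f : Q →ₗ[Λ] M) : Prop where
  projective : Module.Projective Λ Q
  surjective : Function.Surjective f
  superfluous : ∀ N : Submodule Λ Q, N ⊔ LinearMap.ker f = ⊤ → N = ⊤

/-- The functor `Ext^d_Λ(X, -)` on the category `mod Λ` of finitely generated modules. -/
def extFunctorMod (X : FGModuleCat.{u} Λ) (d : ℕ) : FGModuleCat.{u} Λ ⥤ AddCommGrpCat.{u} :=
  forget₂ (FGModuleCat.{u} Λ) (ModuleCat.{u} Λ) ⋙ Abelian.extFunctorObj X.obj d

/-- The pair `(X, Y)` is a `d`-division of `M`. -/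
structure IsDivision (d : ℕ) (M X Y : FGModuleCat.{u} Λ) : Prop where
  left_mem : InAdd (Λ := Λ) M X
  right_mem : InAdd (Λ := Λ) M Y
  add_inter : ∀ Z : FGModuleCat.{u} Λ, InAdd (Λ := Λ) X Z → InAdd (Λ := Λ) Y Z → Subsingleton Z
  not_iso : ¬ Nonempty (extFunctorMod X d ≅ extFunctorMod Y d)
  iso_succ : Nonempty (extFunctorMod X (d + 1) ≅ extFunctorMod Y (d + 1))

/-- `M` has a `d`-division. -/
def HasDivision (d : ℕ) (M : FGModuleCat.{u} Λ) : Prop :=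
  ∃ X Y : FGModuleCat.{u} Λ, IsDivision d M X Y

/-- `Y ∈ ℙ_∞`: `Y` has a projective resolution all of whose terms are in `add P`. -/
def HasAddResolution (P : Type u) [AddCommGroup P] [Module Λ P] (Y : FGModuleCat.{u} Λ) : Prop :=
  ∃ Q : ProjectiveResolution Y.obj, ∀ i : ℕ, InAdd (Λ := Λ) P (Q.complex.X i)

end Modules

section Syzygy

variable {Λ : Type u} [Ring Λ] [IsArtinianRing Λ]

/-- Over an artinian ring every finitely generated module has a projective cover. -/
theorem exists_projectiveCover (M : FGModuleCat.{u} Λ) :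
    ∃ (Q : FGModuleCat.{u} Λ) (f : Q →ₗ[Λ] M), IsProjectiveCover f := by
  classical
  let S : Set ℕ := {l | ∃ (Q : FGModuleCat.{u} Λ) (f : Q →ₗ[Λ] M), Module.Projective Λ Q ∧
    Function.Surjective f ∧ Module.length Λ Q = l}
  have hlen : ∀ Q : FGModuleCat.{u} Λ, ∃ l : ℕ, Module.length Λ Q = l := fun Q ↦
    ⟨_, (ENat.natCast_toNat (Module.length_ne_top (R := Λ) (M := Q))).symm⟩
  have hS : S.Nonempty := by
    obtain ⟨n, f, hf⟩ := Module.Finite.exists_fin' Λ M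
    obtain ⟨l, hl⟩ := hlen (FGModuleCat.of Λ (Fin n → Λ))
    exact ⟨l, FGModuleCat.of Λ (Fin n → Λ), f,
      inferInstanceAs (Module.Projective Λ (Fin n → Λ)), hf, hl⟩
  obtain ⟨Q, f, hQ, hf, hl⟩ := Nat.sInf_mem hS
  refine ⟨Q, f, hQ, hf, fun N hN ↦ ?_⟩
  by_contra hNtop
  have hfN : Function.Surjective (f ∘ₗ N.subtype) := by
    intro m
    obtain ⟨q, rfl⟩ := hf m
    have hq : q ∈ N ⊔ LinearMap.ker f := hN ▸ Submodule.mem_top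
    obtain ⟨x, hx, k, hk, rfl⟩ := Submodule.mem_sup.1 hq
    exact ⟨⟨x, hx⟩, by simp [LinearMap.mem_ker.1 hk]⟩
  obtain ⟨g, hg⟩ := Module.projective_lifting_property (f ∘ₗ N.subtype) f hfN
  let h : Module.End Λ Q := N.subtype ∘ₗ g
  have hh : ∀ q, f (h q) = f q := fun q ↦ LinearMap.congr_fun hg q
  have hpow : ∀ n q, f ((h ^ n) q) = f q := by
    intro n
    induction n with
    | zero => intro q; rfl
    | succ n ih => intro q; rw [pow_succ, Module.End.mul_apply, ih, hh]
  obtain ⟨n, hn⟩ := Filter.eventually_atTop.1 h.eventually_isCompl_ker_pow_range_pow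
  have hc := hn (n + 1) (Nat.le_succ n)
  set I := LinearMap.range (h ^ (n + 1)) with hI
  have hIN : I ≤ N := by
    rintro _ ⟨q, rfl⟩
    rw [pow_succ', Module.End.mul_apply]
    exact (g _).2
  have hItop : I < ⊤ := lt_of_le_of_lt hIN (lt_top_iff_ne_top.2 hNtop)
  have hproj : Module.Projective Λ I :=
    Module.Projective.of_split I.subtype (Submodule.projectionOnto I _ hc.symm)
      (LinearMap.ext fun x ↦ Submodule.projectionOnto_apply_left hc.symm x)
  have hsurj : Function.Surjective (f ∘ₗ I.subtype) := by
    intro m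
    obtain ⟨q, rfl⟩ := hf m
    exact ⟨⟨(h ^ (n + 1)) q, q, rfl⟩, hpow (n + 1) q⟩
  obtain ⟨l, hl'⟩ := hlen (FGModuleCat.of Λ I)
  have h1 : sInf S ≤ l := Nat.sInf_le ⟨FGModuleCat.of Λ I, f ∘ₗ I.subtype, hproj, hsurj, hl'⟩
  have h2 : Module.length Λ I < Module.length Λ Q := Submodule.length_lt hItop.ne
  have h3 : (l : ℕ∞) < (sInf S : ℕ) := by rw [← hl', ← hl]; exact h2
  exact absurd h1 (not_le.2 (by exact_mod_cast h3))

/-- The projective cover `P_0(M)`. -/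
def coverObj (M : FGModuleCat.{u} Λ) : FGModuleCat.{u} Λ :=
  (exists_projectiveCover M).choose

/-- The projective cover map `P_0(M) → M`. -/
def coverMap (M : FGModuleCat.{u} Λ) : coverObj M →ₗ[Λ] M :=
  (exists_projectiveCover M).choose_spec.choose

theorem isProjectiveCover_coverMap (M : FGModuleCat.{u} Λ) : IsProjectiveCover (coverMap M) :=
  (exists_projectiveCover M).choose_spec.choose_spec

/-- The syzygy `Ω(M)`, the kernel of the projective cover of `M`. -/
def syzygy (M : FGModuleCat.{u} Λ) : FGModuleCat.{u} Λ :=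
  FGModuleCat.of Λ (LinearMap.ker (coverMap M))

/-- The iterated syzygy `Ω^n(M)`. -/
def syzygyIter (n : ℕ) (M : FGModuleCat.{u} Λ) : FGModuleCat.{u} Λ :=
  syzygy^[n] M

end Syzygy

section K0

variable (Λ : Type u) [Ring Λ]

/-- The defining relations of `K_0`: `[C] = [A] + [B]` if `C ≅ A ⊕ B`, and `[Q] = 0` if `Q` is
projective. -/
def k0Relations : Set (FreeAbelianGroup (FGModuleCat.{u} Λ)) :=
  {x | ∃ A B C : FGModuleCat.{u} Λ, Nonempty (C ≃ₗ[Λ] A × B) ∧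
      x = FreeAbelianGroup.of C - (FreeAbelianGroup.of A + FreeAbelianGroup.of B)} ∪
  {x | ∃ Q : FGModuleCat.{u} Λ, Module.Projective Λ Q ∧ x = FreeAbelianGroup.of Q}

/-- The abelian group generated by the symbols `[M]`, `M` in `mod Λ`, modulo the relations. -/
abbrev K0 : Type (u + 1) :=
  FreeAbelianGroup (FGModuleCat.{u} Λ) ⧸ AddSubgroup.closure (k0Relations Λ)

variable {Λ}

/-- The class `[M]` in `K_0`. -/
def K0.cls (M : FGModuleCat.{u} Λ) : K0 Λ :=
  QuotientAddGroup.mk (FreeAbelianGroup.of M)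

theorem K0.cls_prod {A B C : FGModuleCat.{u} Λ} (e : C ≃ₗ[Λ] A × B) :
    K0.cls C = K0.cls A + K0.cls B := by
  have h := (QuotientAddGroup.eq_zero_iff _).2 (AddSubgroup.subset_closure
    (show _ ∈ k0Relations Λ from Or.inl ⟨A, B, C, ⟨e⟩, rfl⟩))
  rw [QuotientAddGroup.mk_sub, sub_eq_zero] at h
  exact h

theorem K0.cls_projective (Q : FGModuleCat.{u} Λ) (h : Module.Projective Λ Q) :
    K0.cls Q = 0 :=
  (QuotientAddGroup.eq_zero_iff _).2 (AddSubgroup.subset_closure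
    (show _ ∈ k0Relations Λ from Or.inr ⟨Q, h, rfl⟩))

/-- The subgroup `⟨add M⟩` of `K_0` generated by the indecomposable direct summands of `M`. -/
def addSpan (M : FGModuleCat.{u} Λ) : AddSubgroup (K0 Λ) :=
  AddSubgroup.closure {x | ∃ X : FGModuleCat.{u} Λ, IsSummand (Λ := Λ) X M ∧
    IsIndecomposable (Λ := Λ) X ∧ x = K0.cls X}

end K0

section Omega

variable {Λ : Type u} [Ring Λ]

/-- One half of Schanuel's lemma: the pullback of two surjections `f`, `g` onto `M` is
`ker f × Q'` if `Q'` is projective. -/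
theorem exists_pullback_equiv {Q Q' M : Type u} [AddCommGroup Q] [Module Λ Q] [AddCommGroup Q']
    [Module Λ Q'] [AddCommGroup M] [Module Λ M] (f : Q →ₗ[Λ] M) (g : Q' →ₗ[Λ] M)
    (hf : Function.Surjective f) [Module.Projective Λ Q'] :
    Nonempty (LinearMap.eqLocus (f ∘ₗ LinearMap.fst Λ Q Q') (g ∘ₗ LinearMap.snd Λ Q Q') ≃ₗ[Λ]
      LinearMap.ker f × Q') := by
  obtain ⟨s, hs⟩ := Module.projective_lifting_property f g hf
  have hs' : ∀ q, f (s q) = g q := fun q ↦ LinearMap.congr_fun hs q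
  refine ⟨LinearEquiv.ofLinearMap
    (LinearMap.prod
      (LinearMap.codRestrict _ ((LinearMap.fst Λ Q Q' - s ∘ₗ LinearMap.snd Λ Q Q') ∘ₗ
        Submodule.subtype _) ?_)
      (LinearMap.snd Λ Q Q' ∘ₗ Submodule.subtype _))
    (LinearMap.codRestrict _
      (LinearMap.prod ((LinearMap.ker f).subtype ∘ₗ LinearMap.fst Λ _ _ + s ∘ₗ LinearMap.snd Λ _ _)
        (LinearMap.snd Λ _ _)) ?_) ?_ ?_⟩
  · rintro ⟨⟨a, b⟩, hab⟩
    have hab' : f a = g b := hab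
    simp [hs', hab']
  · rintro ⟨⟨k, hk⟩, b⟩
    have hk' : f k = 0 := hk
    simp [LinearMap.mem_eqLocus, hs', hk']
  · ext x <;> simp
  · ext x <;> simp

theorem K0.cls_ker_eq [IsArtinianRing Λ] {Q Q' M : FGModuleCat.{u} Λ} (f : Q →ₗ[Λ] M) (g : Q' →ₗ[Λ] M)
    (hf : Function.Surjective f) (hg : Function.Surjective g)
    (hQ : Module.Projective Λ Q) (hQ' : Module.Projective Λ Q') :
    K0.cls (FGModuleCat.of Λ (LinearMap.ker f)) = K0.cls (FGModuleCat.of Λ (LinearMap.ker g)) := by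
  obtain ⟨e₁⟩ := exists_pullback_equiv f g hf
  obtain ⟨e₂⟩ := exists_pullback_equiv g f hg
  let σ : LinearMap.eqLocus (f ∘ₗ LinearMap.fst Λ Q Q') (g ∘ₗ LinearMap.snd Λ Q Q') ≃ₗ[Λ]
      LinearMap.eqLocus (g ∘ₗ LinearMap.fst Λ Q' Q) (f ∘ₗ LinearMap.snd Λ Q' Q) :=
    LinearEquiv.ofLinearMap
      (LinearMap.codRestrict _ ((LinearEquiv.prodComm Λ Q Q').toLinearMap ∘ₗ Submodule.subtype _)
        (fun x ↦ x.2.symm))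
      (LinearMap.codRestrict _ ((LinearEquiv.prodComm Λ Q' Q).toLinearMap ∘ₗ Submodule.subtype _)
        (fun x ↦ x.2.symm))
      (by ext x <;> rfl) (by ext x <;> rfl)
  have h₁ := K0.cls_prod (C := FGModuleCat.of Λ (LinearMap.ker f × Q'))
    (A := FGModuleCat.of Λ (LinearMap.ker f)) (B := Q') (LinearEquiv.refl Λ _)
  have h₂ := K0.cls_prod (C := FGModuleCat.of Λ (LinearMap.ker f × Q'))
    (A := FGModuleCat.of Λ (LinearMap.ker g)) (B := Q) (e₁.symm ≪≫ₗ σ ≪≫ₗ e₂)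
  rw [K0.cls_projective Q' hQ', add_zero] at h₁
  rw [K0.cls_projective Q hQ, add_zero] at h₂
  exact h₁.symm.trans h₂

/-- The endomorphism `Ω` of `K_0` induced by the syzygy, `Ω([M]) = [Ω(M)]`. -/
def omega (Λ : Type u) [Ring Λ] [IsArtinianRing Λ] : K0 Λ →+ K0 Λ :=
  QuotientAddGroup.lift (AddSubgroup.closure (k0Relations Λ))
    (FreeAbelianGroup.lift fun M ↦ K0.cls (syzygy M)) <| by
    rw [AddSubgroup.closure_le]
    rintro x (⟨A, B, C, ⟨e⟩, rfl⟩ | ⟨Q, hQ, rfl⟩)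
    · have hA := isProjectiveCover_coverMap A
      have hB := isProjectiveCover_coverMap B
      have hC := isProjectiveCover_coverMap C
      let f := coverMap A
      let g := coverMap B
      let p : (FGModuleCat.of Λ (coverObj A × coverObj B)) →ₗ[Λ] C :=
        e.symm.toLinearMap ∘ₗ f.prodMap g
      have hp : Function.Surjective p :=
        e.symm.surjective.comp (hA.surjective.prodMap hB.surjective)
      have hpr : Module.Projective Λ (FGModuleCat.of Λ (coverObj A × coverObj B)) := by
        have := hA.projective
        have := hB.projective
        exact inferInstanceAs (Module.Projective Λ (coverObj A × coverObj B))
      have hmem : ∀ x : coverObj A × coverObj B,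
          x ∈ LinearMap.ker p ↔ x.1 ∈ LinearMap.ker f ∧ x.2 ∈ LinearMap.ker g := by
        intro x
        have : p x = e.symm (f x.1, g x.2) := rfl
        simp [LinearMap.mem_ker, this]
      have h := K0.cls_ker_eq p (coverMap C) hp hC.surjective hpr hC.projective
      have h' := K0.cls_prod (C := FGModuleCat.of Λ (LinearMap.ker p)) (A := syzygy A)
        (B := syzygy B)
        { toFun := fun x ↦ ⟨⟨x.1.1, (hmem x.1).1 x.2 |>.1⟩, ⟨x.1.2, (hmem x.1).1 x.2 |>.2⟩⟩
          invFun := fun y ↦ ⟨(y.1.1, y.2.1), (hmem _).2 ⟨y.1.2, y.2.2⟩⟩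
          map_add' := fun _ _ ↦ rfl
          map_smul' := fun _ _ ↦ rfl
          left_inv := fun _ ↦ rfl
          right_inv := fun _ ↦ rfl }
      have h'' : K0.cls (syzygy C) = K0.cls (syzygy A) + K0.cls (syzygy B) := h.symm.trans h'
      simp [h'']
    · have h := K0.cls_ker_eq (coverMap Q) (LinearMap.id : Q →ₗ[Λ] Q)
        (isProjectiveCover_coverMap Q).surjective Function.surjective_id
        (isProjectiveCover_coverMap Q).projective hQ
      have hz : K0.cls (FGModuleCat.of Λ (LinearMap.ker (LinearMap.id : Q →ₗ[Λ] Q))) = 0 := by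
        refine K0.cls_projective _ ?_
        have : Subsingleton (LinearMap.ker (LinearMap.id : Q →ₗ[Λ] Q)) := by
          rw [LinearMap.ker_id]; infer_instance
        exact inferInstanceAs (Module.Projective Λ (LinearMap.ker (LinearMap.id : Q →ₗ[Λ] Q)))
      have h' : K0.cls (syzygy Q) = 0 := h.trans hz
      simp [h']

variable [IsArtinianRing Λ]

theorem omega_cls (M : FGModuleCat.{u} Λ) : omega Λ (K0.cls M) = K0.cls (syzygy M) := by
  simp [omega, K0.cls]

/-- The subgroup `Ω^s(⟨add M⟩)` of `K_0`. -/
def omegaSpan (M : FGModuleCat.{u} Λ) (s : ℕ) : AddSubgroup (K0 Λ) :=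
  (AddSubgroup.map (omega Λ))^[s] (addSpan M)

/-- The Igusa-Todorov function `φ_l`: the smallest `n` such that
`Ω : Ω^s(⟨add M⟩) → Ω^(s+1)(⟨add M⟩)` is an isomorphism for all `s ≥ n`. -/
def phi (M : FGModuleCat.{u} Λ) : ℕ :=
  sInf {n : ℕ | ∀ s ≥ n, Set.BijOn (omega Λ) (omegaSpan M s) (omegaSpan M (s + 1))}

/-- The Igusa-Todorov function `ψ_l`: the sum of `φ_l(M)` and the supremum of the finite
projective dimensions of the direct summands of `Ω^(φ_l(M))(M)`. (The zero summand, whose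
projective dimension is `⊥` in Mathlib, does not contribute; the supremum of `∅` is `0`.) -/
def psi (M : FGModuleCat.{u} Λ) : ℕ∞ :=
  phi M + sSup {m : ℕ∞ | ∃ (X : FGModuleCat.{u} Λ) (n : ℕ),
    IsSummand (Λ := Λ) X (syzygyIter (phi M) M) ∧ projectiveDimension X.obj = n ∧ m = n}

end Omega

section Evaluation

variable (Λ : Type u) [Ring Λ] (P : Type u) [AddCommGroup P] [Module Λ P]

/-- The ring `Γ = End_Λ(P)^op`. -/
abbrev Gam : Type u := (Module.End Λ P)ᵐᵒᵖ

variable (Y : Type u) [AddCommGroup Y] [Module Λ Y]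

/-- `Hom_Λ(P, Y)` as a left `Γ`-module: `γ ∈ Γ = End_Λ(P)^op` acts by precomposition. -/
instance homModule : Module (Gam Λ P) (P →ₗ[Λ] Y) where
  smul γ f := f ∘ₗ γ.unop
  one_smul _ := rfl
  mul_smul _ _ _ := rfl
  smul_zero _ := rfl
  smul_add _ _ _ := rfl
  add_smul γ δ f := LinearMap.comp_add γ.unop δ.unop f
  zero_smul f := LinearMap.comp_zero f

theorem gam_smul_apply (γ : Gam Λ P) (f : P →ₗ[Λ] Y) (p : P) : (γ • f) p = f (γ.unop p) := rfl

/-- Over an algebra finite over a noetherian `R`, the module `Hom_Λ(P, Y)` is finite over `R`. -/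
theorem finite_hom_base (R : Type u) [CommRing R] [IsNoetherianRing R] [Algebra R Λ]
    [Module R Y] [IsScalarTower R Λ Y] [SMulCommClass Λ R Y] [Module.Finite R Λ]
    [Module.Finite Λ P] [Module.Finite Λ Y] : Module.Finite R (P →ₗ[Λ] Y) := by
  have : Module.Finite R Y := Module.Finite.trans Λ Y
  obtain ⟨n, π, hπ⟩ := Module.Finite.exists_fin' Λ P
  let ev : (P →ₗ[Λ] Y) →ₗ[R] (Fin n → Y) :=
    { toFun := fun f i ↦ f (π (Pi.single i 1))
      map_add' := fun _ _ ↦ rfl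
      map_smul' := fun _ _ ↦ rfl }
  refine Module.Finite.of_injective ev fun f g hfg ↦ ?_
  have : f ∘ₗ π = g ∘ₗ π := by
    refine LinearMap.pi_ext' fun i ↦ LinearMap.ext_ring ?_
    exact congrFun hfg i
  exact LinearMap.ext fun p ↦ by
    obtain ⟨x, rfl⟩ := hπ p
    exact LinearMap.congr_fun this x

variable [IsArtinAlgebra Λ] [Module.Finite Λ P]

instance isArtinAlgebra_gam : IsArtinAlgebra (Gam Λ P) := by
  obtain ⟨R, _, _, _, _⟩ := IsArtinAlgebra.exists_base (Λ := Λ)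
  let _ : Module R P := Module.compHom P (algebraMap R Λ)
  have : IsScalarTower R Λ P := IsScalarTower.of_algebraMap_smul fun _ _ ↦ rfl
  have : SMulCommClass Λ R P := IsScalarTower.to_smulCommClass'
  have : Module.Finite R (Module.End Λ P) := finite_hom_base Λ P P R
  exact ⟨R, inferInstance, inferInstance, inferInstance,
    Module.Finite.equiv (MulOpposite.opLinearEquiv R : Module.End Λ P ≃ₗ[R] _)⟩

instance finite_hom [Module.Finite Λ Y] : Module.Finite (Gam Λ P) (P →ₗ[Λ] Y) := by
  obtain ⟨R, _, _, _, _⟩ := IsArtinAlgebra.exists_base (Λ := Λ)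
  let _ : Module R P := Module.compHom P (algebraMap R Λ)
  have : IsScalarTower R Λ P := IsScalarTower.of_algebraMap_smul fun _ _ ↦ rfl
  have : SMulCommClass Λ R P := IsScalarTower.to_smulCommClass'
  let _ : Module R Y := Module.compHom Y (algebraMap R Λ)
  have : IsScalarTower R Λ Y := IsScalarTower.of_algebraMap_smul fun _ _ ↦ rfl
  have : SMulCommClass Λ R Y := IsScalarTower.to_smulCommClass'
  have : Module.Finite R (P →ₗ[Λ] Y) := finite_hom_base Λ P Y R
  have : IsScalarTower R (Gam Λ P) (P →ₗ[Λ] Y) := by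
    refine IsScalarTower.of_algebraMap_smul fun r f ↦ LinearMap.ext fun p ↦ ?_
    change f (algebraMap R Λ r • p) = algebraMap R Λ r • f p
    exact f.map_smul _ _
  exact Module.Finite.of_restrictScalars_finite R (Gam Λ P) (P →ₗ[Λ] Y)

/-- The evaluation functor `e_P = Hom_Λ(P, -) : mod Λ → mod Γ` on objects. -/
def evalObj (Y : FGModuleCat.{u} Λ) : FGModuleCat.{u} (Gam Λ P) :=
  FGModuleCat.of (Gam Λ P) (P →ₗ[Λ] Y)

end Evaluation

end

end IgusaTodorov

/-! The functor `Hom(P, -)` is fully faithful on modules with a presentation `Q₁ → Q₀ → M → 0` in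
`add P`, and it restricts there to an equivalence with `mod Γ`; `presentedObj` is a quasi-inverse.
The modules having partial resolutions in `add P` of every length (`IsAddResolved`) are stable under
direct summands, `add` and syzygies. On them `Hom(P, -)` preserves and reflects direct sum
decompositions, projectivity and projective dimension, and it commutes with `Ω`.

For divisions, dimension shifting gives `Ext^d_Λ(X, -) ≃ Ext^d_Γ(Hom(P, X), Hom(P, -))` for resolved
`X`. An isomorphism of functors on `mod Γ` is pulled back along `Hom(P, -)`, and one on `mod Λ` is
pulled back along its section `presentedFunctor`.

For `φ_l`, the comparison `k0Hom` goes from `K₀(Γ)` to `K₀(Λ)`: `Hom(P, -)` may send a projective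
outside `add P` to a nonprojective module, whereas `presentedObj` sends every projective into `add
P`. The map is injective (`k0Hom_injective`): equal classes in `K₀(Λ)` are stably equivalent because
finite length modules cancel, and a stable equivalence between modules generated by `add P` can be
rerouted through projectives in `add P`. It carries `⟨add Hom(P, Y)⟩` onto `⟨add Y⟩` and commutes
with `Ω` on the classes of resolved modules, so `Ω` is injective on corresponding subgroups at the
same steps.

For `ψ_l`, the two syzygies of order `φ_l` correspond, hence so do their summands, with equal
projective dimensions. -/

namespace IgusaTodorov

noncomputable section

/-! ### Direct summands, `add M` and projective covers. -/

section Summands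

variable {Λ : Type u} [Ring Λ]
variable {M N X Q : Type u} [AddCommGroup M] [Module Λ M] [AddCommGroup N] [Module Λ N]
  [AddCommGroup X] [Module Λ X] [AddCommGroup Q] [Module Λ Q]

theorem IsSummand.of_equiv (e : X ≃ₗ[Λ] M) : IsSummand (Λ := Λ) X M :=
  ⟨e, e.symm, by ext; simp⟩

theorem IsSummand.trans (h : IsSummand (Λ := Λ) X M) (h' : IsSummand (Λ := Λ) M N) :
    IsSummand (Λ := Λ) X N := by
  obtain ⟨i, p, hip⟩ := h
  obtain ⟨j, q, hjq⟩ := h'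
  refine ⟨j ∘ₗ i, p ∘ₗ q, ?_⟩
  calc (p ∘ₗ q) ∘ₗ j ∘ₗ i = p ∘ₗ (q ∘ₗ j) ∘ₗ i := rfl
    _ = LinearMap.id := by rw [hjq, LinearMap.id_comp, hip]

theorem IsSummand.pi (h : IsSummand (Λ := Λ) X M) (k : ℕ) :
    IsSummand (Λ := Λ) (Fin k → X) (Fin k → M) := by
  obtain ⟨i, p, hip⟩ := h
  refine ⟨i.compLeft (Fin k), p.compLeft (Fin k), LinearMap.ext fun x ↦ funext fun j ↦ ?_⟩
  exact LinearMap.congr_fun hip (x j)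

theorem IsSummand.finite (h : IsSummand (Λ := Λ) X M) [Module.Finite Λ M] : Module.Finite Λ X := by
  obtain ⟨i, p, hip⟩ := h
  exact Module.Finite.of_surjective p fun x ↦ ⟨i x, LinearMap.congr_fun hip x⟩

theorem IsSummand.projective (h : IsSummand (Λ := Λ) X M) [Module.Projective Λ M] :
    Module.Projective Λ X := by
  obtain ⟨i, p, hip⟩ := h
  exact Module.Projective.of_split i p hip

/-- The image of a retraction is complemented by the kernel. -/
theorem exists_equiv_prod_ker {i : X →ₗ[Λ] M} {p : M →ₗ[Λ] X} (h : p ∘ₗ i = LinearMap.id) :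
    Nonempty (M ≃ₗ[Λ] X × LinearMap.ker p) := by
  have h' : ∀ x, p (i x) = x := fun x ↦ LinearMap.congr_fun h x
  refine ⟨LinearEquiv.ofLinearMap
    (LinearMap.prod p (LinearMap.codRestrict _ (LinearMap.id - i ∘ₗ p) fun m ↦ ?_))
    (i ∘ₗ LinearMap.fst Λ _ _ + Submodule.subtype _ ∘ₗ LinearMap.snd Λ _ _) ?_ ?_⟩
  · simp [h']
  · refine LinearMap.ext fun ⟨x, k, hk⟩ ↦ ?_
    have hk' : p k = 0 := hk
    ext <;> simp [h', hk']
  · ext; simp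

theorem InAdd.of_isSummand (h : IsSummand (Λ := Λ) X Q) (hQ : InAdd (Λ := Λ) M Q) :
    InAdd (Λ := Λ) M X := by
  obtain ⟨n, hn⟩ := hQ
  exact ⟨n, h.trans hn⟩

theorem InAdd.pi_self (M : Type u) [AddCommGroup M] [Module Λ M] (k : ℕ) :
    InAdd (Λ := Λ) M (Fin k → M) :=
  ⟨k, IsSummand.of_equiv (LinearEquiv.refl Λ _)⟩

theorem InAdd.self (M : Type u) [AddCommGroup M] [Module Λ M] : InAdd (Λ := Λ) M M :=
  ⟨1, IsSummand.of_equiv (LinearEquiv.funUnique (Fin 1) Λ M).symm⟩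

theorem InAdd.pi (hQ : InAdd (Λ := Λ) M Q) (k : ℕ) : InAdd (Λ := Λ) M (Fin k → Q) := by
  obtain ⟨n, hn⟩ := hQ
  refine ⟨k * n, (hn.pi k).trans (IsSummand.of_equiv ?_)⟩
  exact (LinearEquiv.curry Λ M (Fin k) (Fin n)).symm ≪≫ₗ
    LinearEquiv.funCongrLeft Λ M finProdFinEquiv.symm

theorem InAdd.finite (h : InAdd (Λ := Λ) M Q) [Module.Finite Λ M] : Module.Finite Λ Q := by
  obtain ⟨n, hn⟩ := h
  exact hn.finite

theorem InAdd.projective (h : InAdd (Λ := Λ) M Q) [Module.Projective Λ M] :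
    Module.Projective Λ Q := by
  obtain ⟨n, hn⟩ := h
  have : Module.Projective Λ (Fin n → M) :=
    Module.Projective.of_equiv (DFinsupp.linearEquivFunOnFintype (R := Λ) (M := fun _ : Fin n ↦ M))
  exact hn.projective

theorem InAdd.trans (h : InAdd (Λ := Λ) M Q) (hM : InAdd (Λ := Λ) N M) : InAdd (Λ := Λ) N Q := by
  obtain ⟨k, hk⟩ := h
  exact InAdd.of_isSummand hk (hM.pi k)

/-- A retract of `M` is covered by a retract of any projective module over `M`, compatibly with the
kernels. -/
theorem IsProjectiveCover.isSummand {C : Type u} [AddCommGroup C] [Module Λ C] [IsNoetherian Λ C]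
    {π : C →ₗ[Λ] X} (hπ : IsProjectiveCover π) [Module.Projective Λ Q] {f : Q →ₗ[Λ] M}
    (hf : Function.Surjective f) (h : IsSummand (Λ := Λ) X M) :
    IsSummand (Λ := Λ) C Q ∧ IsSummand (Λ := Λ) (LinearMap.ker π) (LinearMap.ker f) := by
  obtain ⟨i, p, hip⟩ := h
  have := hπ.projective
  obtain ⟨α, hα⟩ := Module.projective_lifting_property f (i ∘ₗ π) hf
  obtain ⟨β, hβ⟩ := Module.projective_lifting_property π (p ∘ₗ f) hπ.surjective
  have hα' : ∀ c, f (α c) = i (π c) := fun c ↦ LinearMap.congr_fun hα c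
  have hβ' : ∀ q, π (β q) = p (f q) := fun q ↦ LinearMap.congr_fun hβ q
  have hip' : ∀ x, p (i x) = x := fun x ↦ LinearMap.congr_fun hip x
  have hπβα : ∀ c, π (β (α c)) = π c := fun c ↦ by rw [hβ', hα', hip']
  -- `β ∘ α` lies over the identity of `X`, so its range and `ker π` together span `C`; superfluity
  -- of `ker π` gives surjectivity, and noetherianity then gives injectivity.
  have hsurj : Function.Surjective (β ∘ₗ α) := by
    rw [← LinearMap.range_eq_top]
    refine hπ.superfluous _ (eq_top_iff.2 fun c _ ↦ ?_)
    refine Submodule.mem_sup.2 ⟨_, ⟨c, rfl⟩, c - β (α c), ?_, ?_⟩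
    · simp [hπβα]
    · simp
  have hbij : Function.Bijective (β ∘ₗ α) :=
    ⟨IsNoetherian.injective_of_surjective_endomorphism _ hsurj, hsurj⟩
  let ε := LinearEquiv.ofBijective (β ∘ₗ α) hbij
  have hε : ∀ c, ε.symm (β (α c)) = c := fun c ↦ ε.symm_apply_apply c
  have hπε : ∀ c, π (ε.symm c) = π c := fun c ↦ by
    rw [← hπβα]
    exact congrArg π (ε.apply_symm_apply c)
  refine ⟨⟨α, ε.symm.toLinearMap ∘ₗ β, LinearMap.ext hε⟩,
    α.restrict fun c hc ↦ ?_, (ε.symm.toLinearMap ∘ₗ β).restrict fun q hq ↦ ?_, ?_⟩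
  · rw [LinearMap.mem_ker] at hc ⊢
    rw [hα', hc, map_zero]
  · rw [LinearMap.mem_ker] at hq ⊢
    change π (ε.symm (β q)) = 0
    rw [hπε, hβ', hq, map_zero]
  · exact LinearMap.ext fun c ↦ Subtype.ext (hε c)

end Summands

/-! ### Partial resolutions by `add P` and their stability properties. -/

section Presentations

variable {Λ : Type u} [Ring Λ] (P : Type u) [AddCommGroup P] [Module Λ P]

/-- `M` has a partial resolution `Q_{n-1} → ⋯ → Q_0 → M → 0` with all terms in `add P`. -/
def HasAddPresentation : ℕ → (M : Type u) → [AddCommGroup M] → [Module Λ M] → Prop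
  | 0, _, _, _ => True
  | n + 1, M, _, _ => ∃ (Q : Type u) (_ : AddCommGroup Q) (_ : Module Λ Q) (f : Q →ₗ[Λ] M),
      Function.Surjective f ∧ InAdd (Λ := Λ) P Q ∧ HasAddPresentation n (LinearMap.ker f)

/-- `M` has partial resolutions with all terms in `add P` of any length. -/
def IsAddResolved (M : Type u) [AddCommGroup M] [Module Λ M] : Prop :=
  ∀ n, HasAddPresentation (Λ := Λ) P n M

variable {P} {M N X : Type u} [AddCommGroup M] [Module Λ M] [AddCommGroup N] [Module Λ N]
  [AddCommGroup X] [Module Λ X]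

theorem HasAddPresentation.of_succ {n : ℕ} (h : HasAddPresentation (Λ := Λ) P (n + 1) M) :
    HasAddPresentation (Λ := Λ) P n M := by
  induction n generalizing M with
  | zero => trivial
  | succ n ih =>
    obtain ⟨Q, _, _, f, hf, hQ, hK⟩ := h
    exact ⟨Q, _, _, f, hf, hQ, ih hK⟩

theorem HasAddPresentation.of_equiv {n : ℕ} (h : HasAddPresentation (Λ := Λ) P n M)
    (e : M ≃ₗ[Λ] N) : HasAddPresentation (Λ := Λ) P n N := by
  induction n generalizing M N with
  | zero => trivial
  | succ n ih =>
    obtain ⟨Q, _, _, f, hf, hQ, hK⟩ := h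
    exact ⟨Q, _, _, e.toLinearMap ∘ₗ f, e.surjective.comp hf, hQ,
      ih hK (LinearEquiv.ofEq _ _ (LinearEquiv.ker_comp e f).symm)⟩

theorem HasAddPresentation.pi {n : ℕ} (h : HasAddPresentation (Λ := Λ) P n M) (k : ℕ) :
    HasAddPresentation (Λ := Λ) P n (Fin k → M) := by
  induction n generalizing M with
  | zero => trivial
  | succ n ih =>
    obtain ⟨Q, _, _, f, hf, hQ, hK⟩ := h
    refine ⟨_, _, _, f.compLeft (Fin k), hf.comp_left, hQ.pi k, (ih hK).of_equiv
      { toFun := fun x ↦ ⟨fun j ↦ (x j : Q), funext fun j ↦ (x j).2⟩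
        invFun := fun y j ↦ ⟨(y : Fin k → Q) j, congrFun y.2 j⟩
        map_add' := fun _ _ ↦ rfl
        map_smul' := fun _ _ ↦ rfl
        left_inv := fun _ ↦ rfl
        right_inv := fun _ ↦ rfl }⟩

theorem HasAddPresentation.finite [Module.Finite Λ P] {n : ℕ}
    (h : HasAddPresentation (Λ := Λ) P (n + 1) M) : Module.Finite Λ M := by
  obtain ⟨Q, _, _, f, hf, hQ, -⟩ := h
  have := hQ.finite
  exact Module.Finite.of_surjective f hf

theorem HasAddPresentation.of_subsingleton [Subsingleton M] (n : ℕ) :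
    HasAddPresentation (Λ := Λ) P n M := by
  induction n generalizing M with
  | zero => trivial
  | succ n ih =>
    exact ⟨Fin 0 → P, _, _, 0, fun x ↦ ⟨0, Subsingleton.elim _ _⟩, InAdd.pi_self P 0, ih⟩

theorem InAdd.isAddResolved (h : InAdd (Λ := Λ) P M) : IsAddResolved (Λ := Λ) P M := by
  rintro (_ | n)
  · trivial
  · refine ⟨M, _, _, LinearMap.id, Function.surjective_id, h, ?_⟩
    rw [LinearMap.ker_id]
    exact HasAddPresentation.of_subsingleton n

section Covers

variable [IsArtinianRing Λ] [Module.Projective Λ P]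

theorem HasAddPresentation.of_isSummand_cover {n : ℕ} {X : FGModuleCat.{u} Λ}
    (h : HasAddPresentation (Λ := Λ) P (n + 1) M) (hX : IsSummand (Λ := Λ) X M) :
    InAdd (Λ := Λ) P (coverObj X) ∧ ∃ (K : Type u) (_ : AddCommGroup K) (_ : Module Λ K),
      HasAddPresentation (Λ := Λ) P n K ∧ IsSummand (Λ := Λ) (syzygy X) K := by
  obtain ⟨Q, _, _, f, hf, hQ, hK⟩ := h
  have := hQ.projective
  obtain ⟨h1, h2⟩ := (isProjectiveCover_coverMap X).isSummand hf hX
  exact ⟨InAdd.of_isSummand h1 hQ, _, _, _, hK, h2⟩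

theorem HasAddPresentation.inAdd_coverObj {n : ℕ} {X : FGModuleCat.{u} Λ}
    (h : HasAddPresentation (Λ := Λ) P (n + 1) X) : InAdd (Λ := Λ) P (coverObj X) :=
  (h.of_isSummand_cover (IsSummand.of_equiv (LinearEquiv.refl Λ X))).1

variable [Module.Finite Λ P]

/-- Minimality does the work: the projective cover of `X` and its kernel are summands of the cover
and kernel given for `M`, so iterated projective covers resolve `X` within `add P`. -/
theorem HasAddPresentation.of_isSummand {n : ℕ} (h : HasAddPresentation (Λ := Λ) P n M)
    (hX : IsSummand (Λ := Λ) X M) : HasAddPresentation (Λ := Λ) P n X := by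
  induction n generalizing M X with
  | zero => trivial
  | succ n ih =>
    have := h.finite
    have := hX.finite
    obtain ⟨hQ, K, _, _, hK, hs⟩ := h.of_isSummand_cover (X := FGModuleCat.of Λ X) hX
    exact ⟨_, _, _, coverMap (FGModuleCat.of Λ X), (isProjectiveCover_coverMap _).surjective, hQ,
      ih hK hs⟩

theorem HasAddPresentation.syzygy {n : ℕ} {X : FGModuleCat.{u} Λ}
    (h : HasAddPresentation (Λ := Λ) P (n + 1) X) :
    HasAddPresentation (Λ := Λ) P n (syzygy X) := by
  obtain ⟨-, K, _, _, hK, hs⟩ := h.of_isSummand_cover (IsSummand.of_equiv (LinearEquiv.refl Λ X))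
  exact hK.of_isSummand hs

theorem IsAddResolved.of_isSummand (h : IsAddResolved (Λ := Λ) P M)
    (hX : IsSummand (Λ := Λ) X M) : IsAddResolved (Λ := Λ) P X :=
  fun n ↦ (h n).of_isSummand hX

theorem IsAddResolved.of_inAdd (h : IsAddResolved (Λ := Λ) P M)
    (hX : InAdd (Λ := Λ) M X) : IsAddResolved (Λ := Λ) P X := by
  obtain ⟨k, hk⟩ := hX
  exact fun n ↦ ((h n).pi k).of_isSummand hk

theorem IsAddResolved.syzygy {X : FGModuleCat.{u} Λ} (h : IsAddResolved (Λ := Λ) P X) :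
    IsAddResolved (Λ := Λ) P (syzygy X) :=
  fun n ↦ (h (n + 1)).syzygy

theorem IsAddResolved.syzygyIter {X : FGModuleCat.{u} Λ} (h : IsAddResolved (Λ := Λ) P X) (n : ℕ) :
    IsAddResolved (Λ := Λ) P (syzygyIter n X) := by
  induction n generalizing X with
  | zero => exact h
  | succ n ih => exact ih h.syzygy

end Covers

end Presentations

/-! ### `Hom(P, -)` is fully faithful and dense on modules presented by `add P`. -/

section FullyFaithful

variable {Λ : Type u} [Ring Λ] (P : Type u) [AddCommGroup P] [Module Λ P]
  {L M N Q : Type u} [AddCommGroup L] [Module Λ L] [AddCommGroup M] [Module Λ M]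
  [AddCommGroup N] [Module Λ N] [AddCommGroup Q] [Module Λ Q]

/-- The functor `Hom_Λ(P, -)` on morphisms. -/
def homMap (f : M →ₗ[Λ] N) : (P →ₗ[Λ] M) →ₗ[Gam Λ P] (P →ₗ[Λ] N) where
  toFun a := f ∘ₗ a
  map_add' _ _ := LinearMap.comp_add _ _ _
  map_smul' _ _ := rfl

@[simp]
theorem homMap_apply (f : M →ₗ[Λ] N) (a : P →ₗ[Λ] M) : homMap P f a = f ∘ₗ a := rfl

theorem homMap_comp (g : M →ₗ[Λ] N) (f : L →ₗ[Λ] M) :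
    homMap P (g ∘ₗ f) = homMap P g ∘ₗ homMap P f := rfl

theorem homMap_id : homMap P (LinearMap.id : M →ₗ[Λ] M) = LinearMap.id := rfl

/-- `Hom_Λ(P, -)` on isomorphisms. -/
def homEquiv (e : M ≃ₗ[Λ] N) : (P →ₗ[Λ] M) ≃ₗ[Gam Λ P] (P →ₗ[Λ] N) :=
  LinearEquiv.ofLinearMap (homMap P e.toLinearMap) (homMap P e.symm.toLinearMap)
    (by ext; simp) (by ext; simp)

/-- `Hom_Λ(P, -)` preserves binary products. -/
def homProdEquiv : (P →ₗ[Λ] M × N) ≃ₗ[Gam Λ P] (P →ₗ[Λ] M) × (P →ₗ[Λ] N) where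
  toFun a := (LinearMap.fst Λ M N ∘ₗ a, LinearMap.snd Λ M N ∘ₗ a)
  invFun b := b.1.prod b.2
  map_add' _ _ := rfl
  map_smul' _ _ := rfl
  left_inv _ := rfl
  right_inv _ := rfl

/-- `Hom_Λ(P, -)` preserves finite powers. -/
def homPiEquiv (k : ℕ) : (P →ₗ[Λ] (Fin k → M)) ≃ₗ[Gam Λ P] (Fin k → (P →ₗ[Λ] M)) where
  toFun a j := LinearMap.proj j ∘ₗ a
  invFun b := LinearMap.pi b
  map_add' _ _ := rfl
  map_smul' _ _ := rfl
  left_inv _ := rfl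
  right_inv _ := rfl

/-- `Hom_Λ(P, -)` preserves kernels. -/
def homKerEquiv (f : M →ₗ[Λ] N) :
    (P →ₗ[Λ] LinearMap.ker f) ≃ₗ[Gam Λ P] LinearMap.ker (homMap P f) where
  toFun a := ⟨Submodule.subtype _ ∘ₗ a, LinearMap.ext fun x ↦ (a x).2⟩
  invFun b := LinearMap.codRestrict _ b.1 fun x ↦ LinearMap.congr_fun b.2 x
  map_add' _ _ := rfl
  map_smul' _ _ := rfl
  left_inv _ := rfl
  right_inv _ := rfl

/-- `Hom_Λ(P, P)` is the regular module. -/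
def homSelfEquiv : (P →ₗ[Λ] P) ≃ₗ[Gam Λ P] Gam Λ P where
  toFun a := MulOpposite.op a
  invFun γ := γ.unop
  map_add' _ _ := rfl
  map_smul' _ _ := rfl
  left_inv _ := rfl
  right_inv _ := rfl

variable {P}

theorem homMap_surjective [Module.Projective Λ P] {f : M →ₗ[Λ] N} (hf : Function.Surjective f) :
    Function.Surjective (homMap P f) := fun a ↦
  Module.projective_lifting_property f a hf

theorem IsSummand.hom (h : IsSummand (Λ := Λ) M N) :
    IsSummand (Λ := Gam Λ P) (P →ₗ[Λ] M) (P →ₗ[Λ] N) := by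
  obtain ⟨i, p, hip⟩ := h
  exact ⟨homMap P i, homMap P p, by rw [← homMap_comp, hip, homMap_id]⟩

theorem InAdd.hom (h : InAdd (Λ := Λ) M N) : InAdd (Λ := Gam Λ P) (P →ₗ[Λ] M) (P →ₗ[Λ] N) := by
  obtain ⟨n, hn⟩ := h
  exact ⟨n, hn.hom.trans (IsSummand.of_equiv (homPiEquiv P n))⟩

theorem InAdd.projective_hom (h : InAdd (Λ := Λ) P Q) : Module.Projective (Gam Λ P) (P →ₗ[Λ] Q) := by
  have : Module.Projective (Gam Λ P) (P →ₗ[Λ] P) :=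
    Module.Projective.of_equiv (homSelfEquiv P).symm
  exact h.hom.projective

/-- Writing the identity of `Q` as a sum of maps through `P` reduces questions about maps out of `Q`
to maps out of `P`. -/
theorem InAdd.exists_dual_basis (h : InAdd (Λ := Λ) P Q) :
    ∃ (n : ℕ) (a : Fin n → P →ₗ[Λ] Q) (b : Fin n → Q →ₗ[Λ] P),
      ∑ k, a k ∘ₗ b k = LinearMap.id := by
  obtain ⟨n, i, p, hip⟩ := h
  refine ⟨n, fun k ↦ p ∘ₗ LinearMap.single Λ (fun _ ↦ P) k, fun k ↦ LinearMap.proj k ∘ₗ i,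
    LinearMap.ext fun q ↦ ?_⟩
  have := LinearMap.congr_fun hip q
  simp only [LinearMap.coe_sum, Finset.sum_apply, LinearMap.comp_apply, LinearMap.proj_apply,
    LinearMap.single_apply, ← map_sum, Finset.univ_sum_single]
  exact this

theorem InAdd.homMap_injective (h : InAdd (Λ := Λ) P Q) :
    Function.Injective (homMap P : (Q →ₗ[Λ] N) → _) := by
  obtain ⟨n, a, b, hab⟩ := h.exists_dual_basis
  intro f g hfg
  have key : ∀ k, f ∘ₗ a k = g ∘ₗ a k := fun k ↦ LinearMap.congr_fun hfg (a k)
  have h1 : ∀ f : Q →ₗ[Λ] N, f = ∑ k, (f ∘ₗ a k) ∘ₗ b k := fun f ↦ by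
    conv_lhs => rw [← LinearMap.comp_id f, ← hab]
    ext; simp
  rw [h1 f, h1 g]
  simp only [key]

/-- A dual basis expands `c : P → Q` as `∑ (b k ∘ c) • a k` with coefficients in `Γ`, so a
`Γ`-linear `g` is determined by the values `g (a k)` and comes from `∑ g (a k) ∘ b k`. -/
theorem InAdd.homMap_surjective (h : InAdd (Λ := Λ) P Q) :
    Function.Surjective (homMap P : (Q →ₗ[Λ] N) → _) := by
  obtain ⟨n, a, b, hab⟩ := h.exists_dual_basis
  intro g
  refine ⟨∑ k, g (a k) ∘ₗ b k, LinearMap.ext fun c ↦ ?_⟩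
  have h1 : c = ∑ k, (MulOpposite.op (b k ∘ₗ c) : Gam Λ P) • a k := by
    conv_lhs => rw [← LinearMap.id_comp c, ← hab]
    ext x
    simp [gam_smul_apply]
  conv_rhs => rw [h1, map_sum]
  ext x
  simp [gam_smul_apply]

theorem HasAddPresentation.homMap_injective (h : HasAddPresentation (Λ := Λ) P 1 M) :
    Function.Injective (homMap P : (M →ₗ[Λ] N) → _) := by
  obtain ⟨Q, _, _, f, hf, hQ, -⟩ := h
  intro a b hab
  rw [← LinearMap.cancel_right hf]
  apply hQ.homMap_injective
  rw [homMap_comp, homMap_comp, hab]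

/-- Fullness on `add P` realizes `g ∘ Hom(P, f)` by some `b : Q → N`. Faithfulness on the second
term `Q'` shows that `b` kills `ker f`, so `b` descends to `M`. -/
theorem HasAddPresentation.homMap_surjective [Module.Projective Λ P]
    (h : HasAddPresentation (Λ := Λ) P 2 M) :
    Function.Surjective (homMap P : (M →ₗ[Λ] N) → _) := by
  obtain ⟨Q, _, _, f, hf, hQ, Q', _, _, f', hf', hQ', -⟩ := h
  intro g
  obtain ⟨b, hb⟩ := hQ.homMap_surjective (g ∘ₗ homMap P f)
  have h0 : b ∘ₗ (LinearMap.ker f).subtype ∘ₗ f' = 0 := by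
    apply hQ'.homMap_injective
    rw [homMap_comp, hb, LinearMap.comp_assoc, ← homMap_comp]
    have : f ∘ₗ (LinearMap.ker f).subtype ∘ₗ f' = 0 := LinearMap.ext fun x ↦ (f' x).2
    rw [this]
    ext; simp
  have hle : LinearMap.ker f ≤ LinearMap.ker b := by
    intro k hk
    obtain ⟨x, hx⟩ := hf' ⟨k, hk⟩
    have := LinearMap.congr_fun h0 x
    simpa [hx] using this
  refine ⟨(LinearMap.ker f).liftQ b hle ∘ₗ (f.quotKerEquivOfSurjective hf).symm.toLinearMap, ?_⟩
  rw [← LinearMap.cancel_right (IgusaTodorov.homMap_surjective (P := P) hf), ← homMap_comp, ← hb]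
  congr 1
  ext q
  have : (f.quotKerEquivOfSurjective hf).symm (f q) = (LinearMap.ker f).mkQ q := by
    rw [LinearEquiv.symm_apply_eq]
    rfl
  simp [this]

/-- Modules presented by `add P` are isomorphic if their images are. -/
theorem HasAddPresentation.nonempty_equiv [Module.Projective Λ P]
    (hM : HasAddPresentation (Λ := Λ) P 2 M) (hN : HasAddPresentation (Λ := Λ) P 2 N)
    (e : (P →ₗ[Λ] M) ≃ₗ[Gam Λ P] (P →ₗ[Λ] N)) : Nonempty (M ≃ₗ[Λ] N) := by
  obtain ⟨f, hf⟩ := hM.homMap_surjective e.toLinearMap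
  obtain ⟨g, hg⟩ := hN.homMap_surjective e.symm.toLinearMap
  refine ⟨LinearEquiv.ofLinearMap f g ?_ ?_⟩
  · apply hN.of_succ.homMap_injective
    rw [homMap_comp, hf, hg, homMap_id]
    ext; simp
  · apply hM.of_succ.homMap_injective
    rw [homMap_comp, hf, hg, homMap_id]
    ext; simp

theorem HasAddPresentation.isSummand_of_hom [Module.Projective Λ P]
    (hM : HasAddPresentation (Λ := Λ) P 2 M) (hN : HasAddPresentation (Λ := Λ) P 2 N)
    (h : IsSummand (Λ := Gam Λ P) (P →ₗ[Λ] M) (P →ₗ[Λ] N)) : IsSummand (Λ := Λ) M N := by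
  obtain ⟨i, p, hip⟩ := h
  obtain ⟨f, rfl⟩ := hM.homMap_surjective i
  obtain ⟨g, rfl⟩ := hN.homMap_surjective p
  exact ⟨f, g, hM.of_succ.homMap_injective hip⟩

theorem HasAddPresentation.inAdd_of_hom [Module.Projective Λ P]
    (hM : HasAddPresentation (Λ := Λ) P 2 M) (hN : HasAddPresentation (Λ := Λ) P 2 N)
    (h : InAdd (Λ := Gam Λ P) (P →ₗ[Λ] N) (P →ₗ[Λ] M)) : InAdd (Λ := Λ) N M := by
  obtain ⟨n, hn⟩ := h
  exact ⟨n, hM.isSummand_of_hom (hN.pi n) (hn.trans (IsSummand.of_equiv (homPiEquiv P n).symm))⟩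

theorem HasAddPresentation.subsingleton_of_hom
    (hM : HasAddPresentation (Λ := Λ) P 1 M) (h : Subsingleton (P →ₗ[Λ] M)) : Subsingleton M := by
  have : (LinearMap.id : M →ₗ[Λ] M) = 0 :=
    hM.homMap_injective (LinearMap.ext fun a ↦ Subsingleton.elim _ _)
  exact ⟨fun x y ↦ (LinearMap.congr_fun this x).trans (LinearMap.congr_fun this y).symm⟩

/-- Every finitely presented `Γ`-module is of the form `Hom_Λ(P, M)`, with `M` presented by
`add P`. -/
theorem exists_hom_equiv [Module.Projective Λ P] [IsNoetherianRing (Gam Λ P)]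
    (A : Type u) [AddCommGroup A] [Module (Gam Λ P) A] [Module.Finite (Gam Λ P) A] :
    ∃ (M : Type u) (_ : AddCommGroup M) (_ : Module Λ M),
      HasAddPresentation (Λ := Λ) P 2 M ∧ Nonempty ((P →ₗ[Λ] M) ≃ₗ[Gam Λ P] A) := by
  let E (n : ℕ) : (P →ₗ[Λ] (Fin n → P)) ≃ₗ[Gam Λ P] (Fin n → Gam Λ P) :=
    homPiEquiv P n ≪≫ₗ LinearEquiv.piCongrRight fun _ ↦ homSelfEquiv P
  obtain ⟨n, f, hf⟩ := Module.Finite.exists_fin' (Gam Λ P) A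
  let f' := f ∘ₗ (E n).toLinearMap
  have hf' : Function.Surjective f' := hf.comp (E n).surjective
  have : IsNoetherian (Gam Λ P) (P →ₗ[Λ] (Fin n → P)) := isNoetherian_of_linearEquiv (E n).symm
  obtain ⟨m, g, hg⟩ := Module.Finite.exists_fin' (Gam Λ P) (LinearMap.ker f')
  let g' := (LinearMap.ker f').subtype ∘ₗ g ∘ₗ (E m).toLinearMap
  have hg' : LinearMap.range g' = LinearMap.ker f' := by
    rw [LinearMap.range_comp, LinearMap.range_comp, LinearEquiv.range, Submodule.map_top,
      LinearMap.range_eq_top.2 hg, Submodule.map_subtype_top]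
  -- The relation map `Γ^m → Γ^n` of a free presentation of `A` comes from a map `h : P^m → P^n`,
  -- and `coker h` is the required module since `Hom(P, -)` is exact for projective `P`.
  obtain ⟨h, hh⟩ := (InAdd.pi_self P m).homMap_surjective g'
  let π := (LinearMap.range h).mkQ
  have hπ : Function.Surjective π := Submodule.mkQ_surjective _
  refine ⟨(Fin n → P) ⧸ LinearMap.range h, inferInstance, inferInstance, ?_, ⟨?_⟩⟩
  · refine ⟨Fin n → P, _, _, π, hπ, InAdd.pi_self P n, Fin m → P, _, _,
      h.codRestrict _ fun x ↦ by simp [π], ?_, InAdd.pi_self P m, trivial⟩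
    rintro ⟨x, hx⟩
    rw [Submodule.ker_mkQ] at hx
    obtain ⟨y, rfl⟩ := hx
    exact ⟨y, rfl⟩
  · have hker : LinearMap.ker (homMap P π) = LinearMap.ker f' := by
      rw [← hg', ← hh]
      ext a
      constructor
      · intro ha
        have ha' : ∀ x, a x ∈ LinearMap.range h := fun x ↦ by
          rw [← Submodule.ker_mkQ (LinearMap.range h)]
          exact LinearMap.congr_fun ha x
        obtain ⟨c, hc⟩ := Module.projective_lifting_property h.rangeRestrict
          (a.codRestrict _ ha') h.surjective_rangeRestrict
        refine ⟨c, LinearMap.ext fun x ↦ ?_⟩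
        exact congrArg Subtype.val (LinearMap.congr_fun hc x)
      · rintro ⟨c, rfl⟩
        refine LinearMap.ext fun x ↦ ?_
        simp [π]
    exact ((homMap P π).quotKerEquivOfSurjective (homMap_surjective hπ)).symm ≪≫ₗ
      Submodule.quotEquivOfEq _ _ hker ≪≫ₗ f'.quotKerEquivOfSurjective hf'

end FullyFaithful

/-! ### Cancellation of finite length modules from direct sums. -/

section Cancellation

variable {Λ : Type u} [Ring Λ]
variable {M N Z : Type u} [AddCommGroup M] [Module Λ M] [AddCommGroup N] [Module Λ N]
  [AddCommGroup Z] [Module Λ Z]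

/-- Gaussian elimination: when the `Z → Z` block is invertible, the vectors that `e` sends into `N ×
0` form the graph of a map `M → Z`, so they are parametrized by `M`. -/
theorem nonempty_equiv_of_bijective_snd (e : (M × Z) ≃ₗ[Λ] (N × Z))
    (h : Function.Bijective (LinearMap.snd Λ N Z ∘ₗ e.toLinearMap ∘ₗ LinearMap.inr Λ M Z)) :
    Nonempty (M ≃ₗ[Λ] N) := by
  let d := LinearEquiv.ofBijective _ h
  let c : M →ₗ[Λ] Z := LinearMap.snd Λ N Z ∘ₗ e.toLinearMap ∘ₗ LinearMap.inl Λ M Z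
  let s : M →ₗ[Λ] M × Z := LinearMap.prod LinearMap.id (-(d.symm.toLinearMap ∘ₗ c))
  have hsplit : ∀ m z, (e (m, z)).2 = c m + d z := fun m z ↦ by
    have : (m, z) = (m, 0) + (0, z) := by simp
    rw [this, map_add]
    rfl
  have hs : ∀ m, (e (s m)).2 = 0 := fun m ↦ by
    change (e (m, -(d.symm (c m)))).2 = 0
    simp [hsplit]
  refine ⟨LinearEquiv.ofLinearMap (LinearMap.fst Λ N Z ∘ₗ e.toLinearMap ∘ₗ s)
    (LinearMap.fst Λ M Z ∘ₗ e.symm.toLinearMap ∘ₗ LinearMap.inl Λ N Z) ?_ ?_⟩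
  · refine LinearMap.ext fun n ↦ ?_
    have h1 : s (e.symm (n, 0)).1 = e.symm (n, 0) := by
      obtain ⟨⟨m, z⟩, hmz⟩ : ∃ w, e.symm (n, 0) = w := ⟨_, rfl⟩
      rw [hmz]
      have h2 : e (m, z) = (n, 0) := by rw [← hmz, e.apply_symm_apply]
      have h3 := hsplit m z
      rw [h2] at h3
      change (m, -(d.symm (c m))) = (m, z)
      rw [Prod.mk.injEq, neg_eq_iff_eq_neg, LinearEquiv.symm_apply_eq, map_neg]
      exact ⟨rfl, eq_neg_of_add_eq_zero_left h3.symm⟩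
    change (e (s (e.symm (n, 0)).1)).1 = n
    rw [h1, e.apply_symm_apply]
  · refine LinearMap.ext fun m ↦ ?_
    change (e.symm ((e (s m)).1, 0)).1 = m
    rw [← hs m, Prod.mk.eta, e.symm_apply_apply]
    rfl

/-- Fitting's lemma: the kernel and range of a high power of `a` are complementary, so one of them
vanishes. -/
theorem IsIndecomposable.isNilpotent_or_bijective [IsNoetherian Λ Z] [IsArtinian Λ Z]
    (hZ : IsIndecomposable (Λ := Λ) Z) (a : Module.End Λ Z) :
    IsNilpotent a ∨ Function.Bijective a := by
  obtain ⟨n, hn⟩ := Filter.eventually_atTop.1 a.eventually_isCompl_ker_pow_range_pow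
  rcases hZ.2 _ _ (hn (n + 1) n.le_succ) with h | h
  · right
    refine IsArtinian.bijective_of_injective_endomorphism a ?_
    rw [← LinearMap.ker_eq_bot, eq_bot_iff, ← h]
    intro z hz
    rw [LinearMap.mem_ker] at hz ⊢
    rw [pow_succ, Module.End.mul_apply, hz, map_zero]
  · exact Or.inl ⟨n + 1, LinearMap.range_eq_bot.1 h⟩

theorem IsIndecomposable.cancel [IsNoetherian Λ Z] [IsArtinian Λ Z]
    (hZ : IsIndecomposable (Λ := Λ) Z) (e : (M × Z) ≃ₗ[Λ] (N × Z)) : Nonempty (M ≃ₗ[Λ] N) := by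
  let d : Module.End Λ Z := LinearMap.snd Λ N Z ∘ₗ e.toLinearMap ∘ₗ LinearMap.inr Λ M Z
  let b : Z →ₗ[Λ] N := LinearMap.fst Λ N Z ∘ₗ e.toLinearMap ∘ₗ LinearMap.inr Λ M Z
  let d' : Module.End Λ Z := LinearMap.snd Λ M Z ∘ₗ e.symm.toLinearMap ∘ₗ LinearMap.inr Λ N Z
  let c' : N →ₗ[Λ] Z := LinearMap.snd Λ M Z ∘ₗ e.symm.toLinearMap ∘ₗ LinearMap.inl Λ N Z
  -- This is the `Z → Z` block of `e⁻¹ ∘ e = 1`. By Fitting, `d' * d` is either nilpotent, making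
  -- `c' ∘ b` invertible, or bijective, making `d` bijective.
  have hsum : d' * d + c' ∘ₗ b = 1 := LinearMap.ext fun z ↦ by
    have h1 : e (0, z) = (0, d z) + (b z, 0) := by
      ext
      · simp [b]
      · simp [d]
    have h2 := congrArg (fun w ↦ (e.symm w).2) h1
    simp only [e.symm_apply_apply, map_add, Prod.snd_add] at h2
    exact h2.symm
  rcases hZ.isNilpotent_or_bijective (d' * d) with h | h
  · obtain ⟨t, ht⟩ := h.isUnit_one_sub
    have ht' : c' ∘ₗ b = (t : Module.End Λ Z) := by rw [ht, ← hsum]; abel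
    -- This choice makes `d + c ∘ b = 1`, so a shear of `N × Z` by `c` turns the `Z → Z` block of
    -- `e` into the identity.
    let c : N →ₗ[Λ] Z := ((1 - d) * (↑t⁻¹ : Module.End Λ Z)) ∘ₗ c'
    have hc : d + c ∘ₗ b = 1 := by
      have : c ∘ₗ b = ((1 - d) * (↑t⁻¹ : Module.End Λ Z)) * (c' ∘ₗ b) := rfl
      rw [this, ht', mul_assoc, Units.inv_mul, mul_one]
      abel
    refine nonempty_equiv_of_bijective_snd
      (e ≪≫ₗ LinearEquiv.skewProd (LinearEquiv.refl Λ N) (LinearEquiv.refl Λ Z) c) ?_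
    convert Function.bijective_id with z
    funext z
    exact LinearMap.congr_fun hc z
  · refine nonempty_equiv_of_bijective_snd e
      (IsArtinian.bijective_of_injective_endomorphism d ?_)
    exact Function.Injective.of_comp (f := d') h.1

theorem IsIndecomposable.of_forall_prod [Nontrivial Z]
    (h : ∀ A B : Submodule Λ Z, IsCompl A B → A ≠ ⊤ → B ≠ ⊤ → False) :
    IsIndecomposable (Λ := Λ) Z := by
  refine ⟨inferInstance, fun A B hAB ↦ ?_⟩
  by_contra! hne
  refine h A B hAB (fun hA ↦ hne.2 ?_) (fun hB ↦ hne.1 ?_)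
  · rw [hA] at hAB; exact hAB.symm.disjoint.eq_bot_of_le le_top
  · rw [hB] at hAB; exact hAB.disjoint.eq_bot_of_le le_top

/-- Modules of finite length cancel from direct sums. -/
theorem nonempty_equiv_of_prod_equiv [IsNoetherian Λ Z] [IsArtinian Λ Z]
    (e : (M × Z) ≃ₗ[Λ] (N × Z)) : Nonempty (M ≃ₗ[Λ] N) := by
  -- Working with submodules of the fixed artinian module `Z` permits well-founded induction. `M`
  -- and `N` must vary, since cancelling one factor of `W` leaves the other attached to them.
  suffices H : ∀ (W : Submodule Λ Z) (M N : Type u) [AddCommGroup M] [Module Λ M] [AddCommGroup N]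
      [Module Λ N], ((M × W) ≃ₗ[Λ] (N × W)) → Nonempty (M ≃ₗ[Λ] N) from
    H ⊤ M N ((LinearEquiv.refl Λ M).prodCongr Submodule.topEquiv ≪≫ₗ e ≪≫ₗ
      (LinearEquiv.refl Λ N).prodCongr Submodule.topEquiv.symm)
  intro W
  induction W using WellFoundedLT.induction with
  | ind W ih =>
    intro M N _ _ _ _ e
    rcases subsingleton_or_nontrivial W with hW | hW
    · have := Unique.mk' W
      exact ⟨(LinearEquiv.prodUnique (R := Λ)).symm ≪≫ₗ e ≪≫ₗ LinearEquiv.prodUnique⟩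
    by_cases hind : IsIndecomposable (Λ := Λ) W
    · exact hind.cancel e
    · by_contra hcon
      refine hind (IsIndecomposable.of_forall_prod fun A B hAB hA hB ↦ hcon ?_)
      have hlt : ∀ C : Submodule Λ W, C ≠ ⊤ → C.map W.subtype < W := fun C hC ↦ by
        refine lt_of_le_of_ne (Submodule.map_subtype_le W C) fun h ↦ hC ?_
        exact Submodule.map_injective_of_injective W.injective_subtype
          (h.trans (Submodule.map_subtype_top W).symm)
      let E (C : Submodule Λ W) : C ≃ₗ[Λ] C.map W.subtype :=
        Submodule.equivMapOfInjective _ W.injective_subtype C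
      let D : W ≃ₗ[Λ] A.map W.subtype × B.map W.subtype :=
        (Submodule.prodEquivOfIsCompl A B hAB).symm ≪≫ₗ (E A).prodCongr (E B)
      let D' (L : Type u) [AddCommGroup L] [Module Λ L] :
          (L × W) ≃ₗ[Λ] (L × A.map W.subtype) × B.map W.subtype :=
        (LinearEquiv.refl Λ L).prodCongr D ≪≫ₗ (LinearEquiv.prodAssoc Λ L _ _).symm
      obtain ⟨e₁⟩ := ih _ (hlt B hB) _ _ ((D' M).symm ≪≫ₗ e ≪≫ₗ D' N)
      exact ih _ (hlt A hA) _ _ e₁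

end Cancellation

/-! ### Stable equivalence and equality in `K₀`. -/

section StableClasses

variable {Λ : Type u} [Ring Λ]

variable (Λ) in
/-- The zero module. -/
abbrev zeroObj : FGModuleCat.{u} Λ := FGModuleCat.of Λ PUnit.{u + 1}

theorem projective_zeroObj : Module.Projective Λ (zeroObj Λ) :=
  inferInstanceAs (Module.Projective Λ PUnit.{u + 1})

/-- `M` and `N` become isomorphic after adding projective modules. -/
def IsStablyEquiv (M N : FGModuleCat.{u} Λ) : Prop :=
  ∃ Q Q' : FGModuleCat.{u} Λ, Module.Projective Λ Q ∧ Module.Projective Λ Q' ∧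
    Nonempty ((M × Q) ≃ₗ[Λ] (N × Q'))

theorem IsStablyEquiv.of_equiv {M N : FGModuleCat.{u} Λ} (e : M ≃ₗ[Λ] N) : IsStablyEquiv M N :=
  ⟨zeroObj Λ, zeroObj Λ, projective_zeroObj, projective_zeroObj, ⟨e.prodCongr (LinearEquiv.refl Λ _)⟩⟩

theorem IsStablyEquiv.symm {M N : FGModuleCat.{u} Λ} (h : IsStablyEquiv M N) :
    IsStablyEquiv N M := by
  obtain ⟨Q, Q', hQ, hQ', ⟨e⟩⟩ := h
  exact ⟨Q', Q, hQ', hQ, ⟨e.symm⟩⟩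

theorem projective_prod (Q R : FGModuleCat.{u} Λ) (hQ : Module.Projective Λ Q)
    (hR : Module.Projective Λ R) : Module.Projective Λ (FGModuleCat.of Λ (Q × R)) :=
  inferInstanceAs (Module.Projective Λ (Q × R))

/-- Interchange of the last two factors of a product. -/
def prodRightComm (A B C : Type u) [AddCommGroup A] [Module Λ A] [AddCommGroup B] [Module Λ B]
    [AddCommGroup C] [Module Λ C] : ((A × B) × C) ≃ₗ[Λ] ((A × C) × B) :=
  LinearEquiv.prodAssoc Λ A B C ≪≫ₗ
    (LinearEquiv.refl Λ A).prodCongr (LinearEquiv.prodComm Λ B C) ≪≫ₗ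
    (LinearEquiv.prodAssoc Λ A C B).symm

theorem IsStablyEquiv.trans {L M N : FGModuleCat.{u} Λ} (h : IsStablyEquiv L M)
    (h' : IsStablyEquiv M N) : IsStablyEquiv L N := by
  obtain ⟨Q, Q', hQ, hQ', ⟨e⟩⟩ := h
  obtain ⟨R, R', hR, hR', ⟨e'⟩⟩ := h'
  refine ⟨FGModuleCat.of Λ (Q × R), FGModuleCat.of Λ (R' × Q'), projective_prod Q R hQ hR,
    projective_prod R' Q' hR' hQ', ⟨?_⟩⟩
  exact (LinearEquiv.prodAssoc Λ L Q R).symm ≪≫ₗ e.prodCongr (LinearEquiv.refl Λ R) ≪≫ₗ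
    prodRightComm _ _ _ ≪≫ₗ e'.prodCongr (LinearEquiv.refl Λ Q') ≪≫ₗ
    LinearEquiv.prodAssoc Λ N R' Q'

theorem IsStablyEquiv.prod {M N M' N' : FGModuleCat.{u} Λ} (h : IsStablyEquiv M N)
    (h' : IsStablyEquiv M' N') :
    IsStablyEquiv (FGModuleCat.of Λ (M × M')) (FGModuleCat.of Λ (N × N')) := by
  obtain ⟨Q, Q', hQ, hQ', ⟨e⟩⟩ := h
  obtain ⟨R, R', hR, hR', ⟨e'⟩⟩ := h'
  refine ⟨FGModuleCat.of Λ (Q × R), FGModuleCat.of Λ (Q' × R'), projective_prod Q R hQ hR,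
    projective_prod Q' R' hQ' hR', ⟨?_⟩⟩
  exact LinearEquiv.prodProdProdComm Λ M M' Q R ≪≫ₗ e.prodCongr e' ≪≫ₗ
    LinearEquiv.prodProdProdComm Λ N Q' N' R'

variable (Λ) in
/-- Stable equivalence of finitely generated modules. -/
def stableSetoid : Setoid (FGModuleCat.{u} Λ) where
  r := IsStablyEquiv
  iseqv := ⟨fun M ↦ .of_equiv (LinearEquiv.refl Λ M), IsStablyEquiv.symm, IsStablyEquiv.trans⟩

variable (Λ) in
/-- The monoid of stable classes of finitely generated modules under direct sum. -/
def StableClass : Type (u + 1) := Quotient (stableSetoid Λ)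

/-- The stable class of a module. -/
def StableClass.mk (M : FGModuleCat.{u} Λ) : StableClass Λ := Quotient.mk (stableSetoid Λ) M

theorem StableClass.mk_eq_mk {M N : FGModuleCat.{u} Λ} :
    StableClass.mk M = StableClass.mk N ↔ IsStablyEquiv M N :=
  Quotient.eq (r := stableSetoid Λ)

instance : Zero (StableClass Λ) := ⟨StableClass.mk (zeroObj Λ)⟩

instance : Add (StableClass Λ) :=
  ⟨Quotient.map₂ (fun M N ↦ FGModuleCat.of Λ (M × N)) fun _ _ h _ _ h' ↦ h.prod h'⟩

instance : AddCommMonoid (StableClass Λ) where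
  add_assoc := by
    rintro ⟨A⟩ ⟨B⟩ ⟨C⟩
    exact StableClass.mk_eq_mk.2 (.of_equiv (LinearEquiv.prodAssoc Λ A B C))
  zero_add := by
    rintro ⟨A⟩
    exact StableClass.mk_eq_mk.2 (.of_equiv (LinearEquiv.uniqueProd (R := Λ) (M := A)))
  add_zero := by
    rintro ⟨A⟩
    exact StableClass.mk_eq_mk.2 (.of_equiv (LinearEquiv.prodUnique (R := Λ) (M := A)))
  add_comm := by
    rintro ⟨A⟩ ⟨B⟩
    exact StableClass.mk_eq_mk.2 (.of_equiv (LinearEquiv.prodComm Λ A B))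
  nsmul := nsmulRec

theorem StableClass.mk_add_mk (M N : FGModuleCat.{u} Λ) :
    StableClass.mk M + StableClass.mk N = StableClass.mk (FGModuleCat.of Λ (M × N)) := rfl

theorem StableClass.mk_projective (Q : FGModuleCat.{u} Λ) (hQ : Module.Projective Λ Q) :
    StableClass.mk Q = 0 :=
  StableClass.mk_eq_mk.2 ⟨zeroObj Λ, Q, projective_zeroObj, hQ,
    ⟨LinearEquiv.prodComm Λ Q (zeroObj Λ)⟩⟩

theorem StableClass.add_left_cancel_mk [IsArtinianRing Λ] {Z M N : FGModuleCat.{u} Λ}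
    (h : StableClass.mk Z + StableClass.mk M = StableClass.mk Z + StableClass.mk N) :
    StableClass.mk M = StableClass.mk N := by
  rw [mk_add_mk, mk_add_mk, mk_eq_mk] at h
  obtain ⟨Q, Q', hQ, hQ', ⟨e⟩⟩ := h
  obtain ⟨e'⟩ := nonempty_equiv_of_prod_equiv (Z := Z)
    (LinearEquiv.prodComm Λ (M × Q) Z ≪≫ₗ (LinearEquiv.prodAssoc Λ Z M Q).symm ≪≫ₗ e ≪≫ₗ
      LinearEquiv.prodAssoc Λ Z N Q' ≪≫ₗ (LinearEquiv.prodComm Λ (N × Q') Z).symm)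
  exact mk_eq_mk.2 ⟨Q, Q', hQ, hQ', ⟨e'⟩⟩

/-- Cancellativity is what makes the monoid of stable classes embed in its Grothendieck group, so
that equality in `K₀` can be read back on modules. -/
instance [IsArtinianRing Λ] : IsCancelAdd (StableClass Λ) where
  add_left_cancel := by
    rintro ⟨Z⟩ ⟨M⟩ ⟨N⟩ h
    exact StableClass.add_left_cancel_mk h
  add_right_cancel := by
    rintro ⟨Z⟩ ⟨M⟩ ⟨N⟩ h
    refine StableClass.add_left_cancel_mk (Z := Z) ?_
    rw [add_comm, add_comm (StableClass.mk Z)]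
    exact h

variable (Λ) in
/-- The comparison of `K_0` with the Grothendieck group of the monoid of stable classes. -/
def k0ToGrothendieck : K0 Λ →+ Algebra.GrothendieckAddGroup (StableClass Λ) :=
  QuotientAddGroup.lift (AddSubgroup.closure (k0Relations Λ))
    (FreeAbelianGroup.lift fun M ↦ Algebra.GrothendieckAddGroup.of (StableClass.mk M)) <| by
    rw [AddSubgroup.closure_le]
    rintro x (⟨A, B, C, ⟨e⟩, rfl⟩ | ⟨Q, hQ, rfl⟩)
    · have h : StableClass.mk C = StableClass.mk A + StableClass.mk B :=
        StableClass.mk_eq_mk.2 (.of_equiv e)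
      simp [h]
    · simp [StableClass.mk_projective Q hQ]

/-- Equality in `K_0` is stable equivalence. -/
theorem K0.isStablyEquiv_of_cls_eq [IsArtinianRing Λ] {M N : FGModuleCat.{u} Λ}
    (h : K0.cls M = K0.cls N) : IsStablyEquiv M N := by
  have h' : k0ToGrothendieck Λ (K0.cls M) = k0ToGrothendieck Λ (K0.cls N) := by rw [h]
  simp only [k0ToGrothendieck, K0.cls, QuotientAddGroup.lift_mk, FreeAbelianGroup.lift_apply_of]
    at h'
  exact StableClass.mk_eq_mk.1 (Algebra.GrothendieckAddGroup.of_injective h')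

theorem K0.cls_congr {M N : FGModuleCat.{u} Λ} (e : M ≃ₗ[Λ] N) : K0.cls M = K0.cls N := by
  have h := K0.cls_prod (C := M) (A := N) (B := zeroObj Λ)
    (e ≪≫ₗ (LinearEquiv.prodUnique (R := Λ)).symm)
  rwa [K0.cls_projective _ projective_zeroObj, add_zero] at h

theorem K0.exists_cls_sub_cls (x : K0 Λ) : ∃ M N : FGModuleCat.{u} Λ, x = K0.cls M - K0.cls N := by
  obtain ⟨x, rfl⟩ := QuotientAddGroup.mk_surjective x
  have hO : K0.cls (zeroObj Λ) = 0 := K0.cls_projective _ projective_zeroObj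
  induction x using FreeAbelianGroup.induction_on with
  | zero => exact ⟨zeroObj Λ, zeroObj Λ, by simp⟩
  | of M => exact ⟨M, zeroObj Λ, by rw [hO, sub_zero]; rfl⟩
  | neg M _ => exact ⟨zeroObj Λ, M, by rw [hO, zero_sub]; rfl⟩
  | add x y hx hy =>
    obtain ⟨M, N, hx⟩ := hx
    obtain ⟨M', N', hy⟩ := hy
    refine ⟨FGModuleCat.of Λ (M × M'), FGModuleCat.of Λ (N × N'), ?_⟩
    have h1 := K0.cls_prod (C := FGModuleCat.of Λ (M × M')) (LinearEquiv.refl Λ (M × M'))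
    have h2 := K0.cls_prod (C := FGModuleCat.of Λ (N × N')) (LinearEquiv.refl Λ (N × N'))
    rw [QuotientAddGroup.mk_add, hx, hy, h1, h2]
    abel

/-- Modules which are isomorphic modulo maps that factor through projectives have the same class. -/
theorem K0.cls_eq_of_stable [IsNoetherianRing Λ] {A B R R' : FGModuleCat.{u} Λ}
    (hR : Module.Projective Λ R) (hR' : Module.Projective Λ R')
    (f : A →ₗ[Λ] B) (g : B →ₗ[Λ] A) (a : A →ₗ[Λ] R) (b : R →ₗ[Λ] A)
    (a' : B →ₗ[Λ] R') (b' : R' →ₗ[Λ] B)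
    (h : g ∘ₗ f + b ∘ₗ a = LinearMap.id) (h' : f ∘ₗ g + b' ∘ₗ a' = LinearMap.id) :
    K0.cls A = K0.cls B := by
  let i : A →ₗ[Λ] B × R := f.prod a
  let p : B × R →ₗ[Λ] A := g.coprod b
  have hip : p ∘ₗ i = LinearMap.id := by
    rw [← h]
    ext
    simp [p, i]
  obtain ⟨e⟩ := exists_equiv_prod_ker hip
  have hpi : ∀ x : A, p (i x) = x := fun x ↦ LinearMap.congr_fun hip x
  -- `B × R` is `A × ker p`. The projector `id - i ∘ p` onto `ker p` factors as `v ∘ u` through the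
  -- projective `R' × (R × R)`, using `id - f ∘ g = b' ∘ a'`; hence `ker p` is projective.
  have hC : Module.Projective Λ (FGModuleCat.of Λ (LinearMap.ker p)) := by
    let u : B × R →ₗ[Λ] R' × (R × R) :=
      (a' ∘ₗ LinearMap.fst Λ B R).prod ((LinearMap.snd Λ B R).prod (a ∘ₗ p))
    let v : R' × (R × R) →ₗ[Λ] B × R :=
      (b'.prod 0).coprod (((-(f ∘ₗ b)).prod LinearMap.id).coprod ((0 : R →ₗ[Λ] B).prod
        (-LinearMap.id)))
    have huv : v ∘ₗ u = LinearMap.id - i ∘ₗ p := by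
      refine LinearMap.ext fun ⟨x, r⟩ ↦ ?_
      have hx : b' (a' x) = x - f (g x) := eq_sub_of_add_eq' (LinearMap.congr_fun h' x)
      ext
      · simp [v, u, i, p, hx]
        abel
      · simp [v, u, i, p]
        abel
    have hproj : Module.Projective Λ (LinearMap.ker p) := by
      have : Module.Projective Λ (R' × (R × R)) := inferInstance
      refine Module.Projective.of_split (u ∘ₗ (LinearMap.ker p).subtype)
        (LinearMap.codRestrict (LinearMap.ker p) (LinearMap.id - i ∘ₗ p) (fun y ↦ by simp [hpi])
          ∘ₗ v) (LinearMap.ext fun ⟨k, hk⟩ ↦ Subtype.ext ?_)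
      have hk' : p k = 0 := hk
      have h3 : v (u k) = k := by
        have := LinearMap.congr_fun huv k
        simpa [hk'] using this
      change v (u k) - i (p (v (u k))) = k
      rw [h3, hk', map_zero, sub_zero]
    exact hproj
  have h1 := K0.cls_prod (C := FGModuleCat.of Λ (B × R)) (A := A)
    (B := FGModuleCat.of Λ (LinearMap.ker p)) e
  have h2 := K0.cls_prod (C := FGModuleCat.of Λ (B × R)) (A := B) (B := R) (LinearEquiv.refl Λ _)
  rw [K0.cls_projective _ hC, add_zero] at h1
  rw [K0.cls_projective _ hR, add_zero] at h2
  exact h1.symm.trans h2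

end StableClasses

/-! ### Products, decompositions and maps factoring through projectives. -/

section Products

variable {Λ : Type u} [Ring Λ] {P : Type u} [AddCommGroup P] [Module Λ P]
  {M N Q R : Type u} [AddCommGroup M] [Module Λ M] [AddCommGroup N] [Module Λ N]
  [AddCommGroup Q] [Module Λ Q] [AddCommGroup R] [Module Λ R]

theorem IsSummand.prod (h : IsSummand (Λ := Λ) M Q) (h' : IsSummand (Λ := Λ) N R) :
    IsSummand (Λ := Λ) (M × N) (Q × R) := by
  obtain ⟨i, p, hip⟩ := h
  obtain ⟨j, q, hjq⟩ := h'
  exact ⟨i.prodMap j, p.prodMap q, by rw [LinearMap.prodMap_comp, hip, hjq, LinearMap.prodMap_id]⟩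

theorem isSummand_prod_left : IsSummand (Λ := Λ) M (M × N) :=
  ⟨LinearMap.inl Λ M N, LinearMap.fst Λ M N, LinearMap.fst_comp_inl Λ M N⟩

theorem isSummand_prod_right : IsSummand (Λ := Λ) N (M × N) :=
  ⟨LinearMap.inr Λ M N, LinearMap.snd Λ M N, LinearMap.snd_comp_inr Λ M N⟩

theorem InAdd.prod (h : InAdd (Λ := Λ) P Q) (h' : InAdd (Λ := Λ) P R) :
    InAdd (Λ := Λ) P (Q × R) := by
  obtain ⟨n, hn⟩ := h
  obtain ⟨m, hm⟩ := h'
  refine ⟨n + m, (hn.prod hm).trans (IsSummand.of_equiv ?_)⟩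
  exact (LinearEquiv.sumArrowLequivProdArrow (Fin n) (Fin m) Λ P).symm ≪≫ₗ
    LinearEquiv.funCongrLeft Λ P finSumFinEquiv.symm

theorem HasAddPresentation.prod {n : ℕ} (h : HasAddPresentation (Λ := Λ) P n M)
    (h' : HasAddPresentation (Λ := Λ) P n N) : HasAddPresentation (Λ := Λ) P n (M × N) := by
  induction n generalizing M N with
  | zero => trivial
  | succ n ih =>
    obtain ⟨Q, _, _, f, hf, hQ, hK⟩ := h
    obtain ⟨R, _, _, g, hg, hR, hL⟩ := h'
    refine ⟨Q × R, _, _, f.prodMap g, hf.prodMap hg, hQ.prod hR, (ih hK hL).of_equiv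
      { toFun := fun x ↦ ⟨(x.1, x.2), Prod.ext x.1.2 x.2.2⟩
        invFun := fun y ↦ (⟨y.1.1, congrArg Prod.fst y.2⟩, ⟨y.1.2, congrArg Prod.snd y.2⟩)
        map_add' := fun _ _ ↦ rfl
        map_smul' := fun _ _ ↦ rfl
        left_inv := fun _ ↦ rfl
        right_inv := fun _ ↦ rfl }⟩

/-- External decompositions, unlike pairs of complementary submodules, can be transported by an
additive functor. -/
theorem isIndecomposable_iff_prod : IsIndecomposable (Λ := Λ) M ↔ Nontrivial M ∧
    ∀ (A B : Type u) [AddCommGroup A] [Module Λ A] [AddCommGroup B] [Module Λ B],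
      (M ≃ₗ[Λ] A × B) → Subsingleton A ∨ Subsingleton B := by
  refine and_congr_right fun _ ↦ ⟨fun h A B _ _ _ _ e ↦ ?_, fun h A B hAB ↦ ?_⟩
  · have hc := (Submodule.orderIsoMapComap e.symm).isCompl
      (LinearMap.isCompl_range_inl_inr (R := Λ) (M := A) (M₂ := B))
    rcases h _ _ hc with h0 | h0
    · rw [map_eq_bot_iff, LinearMap.range_eq_bot] at h0
      have h1 : ∀ a : A, a = 0 := fun a ↦ congrArg Prod.fst (LinearMap.congr_fun h0 a)
      exact Or.inl ⟨fun a b ↦ (h1 a).trans (h1 b).symm⟩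
    · rw [map_eq_bot_iff, LinearMap.range_eq_bot] at h0
      have h1 : ∀ b : B, b = 0 := fun b ↦ congrArg Prod.snd (LinearMap.congr_fun h0 b)
      exact Or.inr ⟨fun a b ↦ (h1 a).trans (h1 b).symm⟩
  · rcases h A B (Submodule.prodEquivOfIsCompl A B hAB).symm with h0 | h0
    · exact Or.inl ((Submodule.subsingleton_iff_eq_bot).1 h0)
    · exact Or.inr ((Submodule.subsingleton_iff_eq_bot).1 h0)

/-- A map which factors through a projective module factors through any projective module over its
target. -/
theorem exists_factor [Module.Projective Λ Q] (a : M →ₗ[Λ] Q) (b : Q →ₗ[Λ] N) {π : R →ₗ[Λ] N}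
    (hπ : Function.Surjective π) : ∃ c : M →ₗ[Λ] R, π ∘ₗ c = b ∘ₗ a := by
  obtain ⟨s, hs⟩ := Module.projective_lifting_property π b hπ
  exact ⟨s ∘ₗ a, by rw [← LinearMap.comp_assoc, hs]⟩

end Products

/-! ### Comparison of `K₀`, syzygies and `φ_l` over `Λ` and `Γ`. -/

section Comparison

variable {Λ : Type u} [Ring Λ] [IsArtinAlgebra Λ]
  (P : Type u) [AddCommGroup P] [Module Λ P] [Module.Finite Λ P]

variable {P} in
-- The projectives in a stable equivalence may lie outside `add P`, where `Hom(P, -)` can destroy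
-- projectivity. The maps through them are therefore refactored through the modules `R`, `R'` of
-- `add P` covering `M` and `N`.
theorem HasAddPresentation.cls_evalObj_eq {M N : FGModuleCat.{u} Λ}
    (hM : HasAddPresentation (Λ := Λ) P 1 M) (hN : HasAddPresentation (Λ := Λ) P 1 N)
    (h : IsStablyEquiv M N) : K0.cls (evalObj Λ P M) = K0.cls (evalObj Λ P N) := by
  obtain ⟨Q, Q', hQ, hQ', ⟨e⟩⟩ := h
  obtain ⟨R, _, _, π, hπ, hR, -⟩ := hM
  obtain ⟨R', _, _, π', hπ', hR', -⟩ := hN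
  have := hR.finite
  have := hR'.finite
  let f : M →ₗ[Λ] N := LinearMap.fst Λ N Q' ∘ₗ e.toLinearMap ∘ₗ LinearMap.inl Λ M Q
  let g : N →ₗ[Λ] M := LinearMap.fst Λ M Q ∘ₗ e.symm.toLinearMap ∘ₗ LinearMap.inl Λ N Q'
  obtain ⟨c, hc⟩ := exists_factor
    (LinearMap.snd Λ N Q' ∘ₗ e.toLinearMap ∘ₗ LinearMap.inl Λ M Q)
    (LinearMap.fst Λ M Q ∘ₗ e.symm.toLinearMap ∘ₗ LinearMap.inr Λ N Q') hπ
  obtain ⟨c', hc'⟩ := exists_factor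
    (LinearMap.snd Λ M Q ∘ₗ e.symm.toLinearMap ∘ₗ LinearMap.inl Λ N Q')
    (LinearMap.fst Λ N Q' ∘ₗ e.toLinearMap ∘ₗ LinearMap.inr Λ M Q) hπ'
  have h1 : g ∘ₗ f + π ∘ₗ c = LinearMap.id := by
    rw [hc]
    ext m
    have : (e.symm ((e (m, 0)).1, 0)) + (e.symm (0, (e (m, 0)).2)) = (m, 0) := by
      rw [← map_add]
      simp
    exact congrArg Prod.fst this
  have h2 : f ∘ₗ g + π' ∘ₗ c' = LinearMap.id := by
    rw [hc']
    ext m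
    have : (e ((e.symm (m, 0)).1, 0)) + (e (0, (e.symm (m, 0)).2)) = (m, 0) := by
      rw [← map_add]
      simp
    exact congrArg Prod.fst this
  refine K0.cls_eq_of_stable (R := evalObj Λ P (FGModuleCat.of Λ R))
    (R' := evalObj Λ P (FGModuleCat.of Λ R')) hR.projective_hom hR'.projective_hom
    (homMap P f) (homMap P g) (homMap P c) (homMap P π) (homMap P c') (homMap P π') ?_ ?_
  · exact congrArg (homMap P) h1
  · exact congrArg (homMap P) h2

variable [Module.Projective Λ P]

theorem exists_presentedObj (A : FGModuleCat.{u} (Gam Λ P)) : ∃ M : FGModuleCat.{u} Λ,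
    HasAddPresentation (Λ := Λ) P 2 M ∧ Nonempty (evalObj Λ P M ≃ₗ[Gam Λ P] A) := by
  obtain ⟨M, _, _, hM, he⟩ := exists_hom_equiv (Λ := Λ) (P := P) A
  have := hM.finite
  exact ⟨FGModuleCat.of Λ M, hM, he⟩

/-- The `Λ`-module presented by `add P` that corresponds to a `Γ`-module. -/
def presentedObj (A : FGModuleCat.{u} (Gam Λ P)) : FGModuleCat.{u} Λ :=
  (exists_presentedObj P A).choose

theorem hasAddPresentation_presentedObj (A : FGModuleCat.{u} (Gam Λ P)) :
    HasAddPresentation (Λ := Λ) P 2 (presentedObj P A) :=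
  (exists_presentedObj P A).choose_spec.1

/-- `Hom_Λ(P, -)` is essentially surjective. -/
def evalPresentedEquiv (A : FGModuleCat.{u} (Gam Λ P)) :
    evalObj Λ P (presentedObj P A) ≃ₗ[Gam Λ P] A :=
  (exists_presentedObj P A).choose_spec.2.some

variable {P}

theorem HasAddPresentation.nonempty_presentedObj_equiv {M : FGModuleCat.{u} Λ}
    (hM : HasAddPresentation (Λ := Λ) P 2 M) {A : FGModuleCat.{u} (Gam Λ P)}
    (e : evalObj Λ P M ≃ₗ[Gam Λ P] A) : Nonempty (presentedObj P A ≃ₗ[Λ] M) :=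
  (hasAddPresentation_presentedObj P A).nonempty_equiv hM (evalPresentedEquiv P A ≪≫ₗ e.symm)

theorem HasAddPresentation.presentedObj_isSummand {M : FGModuleCat.{u} Λ}
    (hM : HasAddPresentation (Λ := Λ) P 2 M) {A : FGModuleCat.{u} (Gam Λ P)}
    (h : IsSummand (Λ := Gam Λ P) A (evalObj Λ P M)) :
    IsSummand (Λ := Λ) (presentedObj P A) M :=
  (hasAddPresentation_presentedObj P A).isSummand_of_hom hM
    ((IsSummand.of_equiv (evalPresentedEquiv P A)).trans h)

theorem HasAddPresentation.presentedObj_inAdd {M : FGModuleCat.{u} Λ}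
    (hM : HasAddPresentation (Λ := Λ) P 2 M) {A : FGModuleCat.{u} (Gam Λ P)}
    (h : InAdd (Λ := Gam Λ P) (evalObj Λ P M) A) :
    InAdd (Λ := Λ) M (presentedObj P A) :=
  (hasAddPresentation_presentedObj P A).inAdd_of_hom hM
    (h.of_isSummand (IsSummand.of_equiv (evalPresentedEquiv P A)))

/-- A finitely generated projective is a summand of some `Γ^n`, and `Γ` is `Hom(P, P)`. -/
theorem inAdd_presentedObj_of_projective (Q : FGModuleCat.{u} (Gam Λ P))
    (hQ : Module.Projective (Gam Λ P) Q) : InAdd (Λ := Λ) P (presentedObj P Q) := by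
  refine HasAddPresentation.presentedObj_inAdd (M := FGModuleCat.of Λ P)
    ((InAdd.self P).isAddResolved 2) ?_
  obtain ⟨n, f, hf⟩ := Module.Finite.exists_fin' (Gam Λ P) Q
  obtain ⟨s, hs⟩ := Module.projective_lifting_property f LinearMap.id hf
  refine InAdd.of_isSummand (Q := Fin n → Gam Λ P) ⟨s, f, hs⟩ (InAdd.pi ?_ n)
  exact InAdd.of_isSummand (IsSummand.of_equiv (homSelfEquiv P).symm) (InAdd.self _)

theorem HasAddPresentation.projective_iff {M : FGModuleCat.{u} Λ}
    (hM : HasAddPresentation (Λ := Λ) P 2 M) :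
    Module.Projective Λ M ↔ Module.Projective (Gam Λ P) (evalObj Λ P M) := by
  constructor
  · intro h
    obtain ⟨Q, _, _, f, hf, hQ, -⟩ := hM
    obtain ⟨s, hs⟩ := Module.projective_lifting_property f LinearMap.id hf
    exact (InAdd.of_isSummand ⟨s, f, hs⟩ hQ).projective_hom
  · intro h
    obtain ⟨e⟩ := hM.nonempty_presentedObj_equiv (LinearEquiv.refl _ _)
    have := (inAdd_presentedObj_of_projective _ h).projective
    exact Module.Projective.of_equiv e

theorem HasAddPresentation.isIndecomposable_iff {M : FGModuleCat.{u} Λ}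
    (hM : HasAddPresentation (Λ := Λ) P 2 M) :
    IsIndecomposable (Λ := Λ) M ↔ IsIndecomposable (Λ := Gam Λ P) (evalObj Λ P M) := by
  rw [isIndecomposable_iff_prod, isIndecomposable_iff_prod]
  refine and_congr ?_ ⟨fun h A B _ _ _ _ e ↦ ?_, fun h A B _ _ _ _ e ↦ ?_⟩
  · rw [← not_subsingleton_iff_nontrivial, ← not_subsingleton_iff_nontrivial, not_iff_not]
    refine ⟨fun h ↦ ?_, hM.of_succ.subsingleton_of_hom⟩
    exact ⟨fun a b ↦ LinearMap.ext fun x ↦ Subsingleton.elim _ _⟩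
  · have hA : Module.Finite (Gam Λ P) A := (isSummand_prod_left.trans (.of_equiv e.symm)).finite
    have hB : Module.Finite (Gam Λ P) B :=
      (isSummand_prod_right.trans (.of_equiv e.symm)).finite
    let FA : FGModuleCat.{u} Λ := presentedObj P (FGModuleCat.of _ A)
    let FB : FGModuleCat.{u} Λ := presentedObj P (FGModuleCat.of _ B)
    obtain ⟨e'⟩ := hM.nonempty_equiv ((hasAddPresentation_presentedObj P (FGModuleCat.of _ A)).prod
      (hasAddPresentation_presentedObj P (FGModuleCat.of _ B)))
      (e ≪≫ₗ ((evalPresentedEquiv P (FGModuleCat.of _ A)).prodCongr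
        (evalPresentedEquiv P (FGModuleCat.of _ B))).symm ≪≫ₗ (homProdEquiv P).symm)
    refine (h FA FB e').imp (fun h0 ↦ ?_) fun h0 ↦ ?_
    · exact ⟨fun a b ↦ (evalPresentedEquiv P (FGModuleCat.of _ A)).symm.injective
        (LinearMap.ext fun x ↦ h0.elim _ _)⟩
    · exact ⟨fun a b ↦ (evalPresentedEquiv P (FGModuleCat.of _ B)).symm.injective
        (LinearMap.ext fun x ↦ h0.elim _ _)⟩
  · have hA := hM.of_isSummand (isSummand_prod_left.trans (.of_equiv e.symm))
    have hB := hM.of_isSummand (isSummand_prod_right.trans (.of_equiv e.symm))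
    exact (h _ _ (homEquiv P e ≪≫ₗ homProdEquiv P)).imp hA.of_succ.subsingleton_of_hom
      hB.of_succ.subsingleton_of_hom

variable (P) in
/-- The homomorphism of `K_0` induced by `A ↦ presentedObj P A`. -/
def k0Hom : K0 (Gam Λ P) →+ K0 Λ :=
  QuotientAddGroup.lift (AddSubgroup.closure (k0Relations (Gam Λ P)))
    (FreeAbelianGroup.lift fun A ↦ K0.cls (presentedObj P A)) <| by
    -- Both relations are respected: `presentedObj` preserves products up to isomorphism and sends
    -- projectives into `add P`.
    rw [AddSubgroup.closure_le]
    rintro x (⟨A, B, C, ⟨e⟩, rfl⟩ | ⟨Q, hQ, rfl⟩)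
    · obtain ⟨e'⟩ := (hasAddPresentation_presentedObj P C).nonempty_equiv
        ((hasAddPresentation_presentedObj P A).prod (hasAddPresentation_presentedObj P B))
        (evalPresentedEquiv P C ≪≫ₗ e ≪≫ₗ ((evalPresentedEquiv P A).prodCongr
          (evalPresentedEquiv P B)).symm ≪≫ₗ (homProdEquiv P).symm)
      simp [K0.cls_prod e']
    · simp [K0.cls_projective _ (inAdd_presentedObj_of_projective Q hQ).projective]

theorem k0Hom_cls (A : FGModuleCat.{u} (Gam Λ P)) :
    k0Hom P (K0.cls A) = K0.cls (presentedObj P A) := by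
  simp [k0Hom, K0.cls]

theorem HasAddPresentation.k0Hom_cls {M : FGModuleCat.{u} Λ}
    (hM : HasAddPresentation (Λ := Λ) P 2 M) {A : FGModuleCat.{u} (Gam Λ P)}
    (e : evalObj Λ P M ≃ₗ[Gam Λ P] A) : k0Hom P (K0.cls A) = K0.cls M := by
  rw [IgusaTodorov.k0Hom_cls]
  exact K0.cls_congr (hM.nonempty_presentedObj_equiv e).some

/-- An element of the kernel is a difference of two classes whose presented modules are stably
equivalent over `Λ`; `cls_evalObj_eq` carries this back to `Γ`. -/
theorem k0Hom_injective : Function.Injective (k0Hom (Λ := Λ) P) := by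
  rw [injective_iff_map_eq_zero]
  intro x hx
  obtain ⟨A, B, rfl⟩ := K0.exists_cls_sub_cls x
  rw [map_sub, sub_eq_zero, k0Hom_cls, k0Hom_cls] at hx
  have h := (hasAddPresentation_presentedObj P A).of_succ.cls_evalObj_eq
    (hasAddPresentation_presentedObj P B).of_succ (K0.isStablyEquiv_of_cls_eq hx)
  rw [K0.cls_congr (evalPresentedEquiv P A), K0.cls_congr (evalPresentedEquiv P B)] at h
  rw [h, sub_self]

/-- `Hom_Λ(P, -)` commutes with syzygies of modules resolved by `add P`. -/
theorem HasAddPresentation.nonempty_syzygy_equiv {M : FGModuleCat.{u} Λ}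
    (hM : HasAddPresentation (Λ := Λ) P 2 M) {A : FGModuleCat.{u} (Gam Λ P)}
    (e : evalObj Λ P M ≃ₗ[Gam Λ P] A) :
    Nonempty (evalObj Λ P (IgusaTodorov.syzygy M) ≃ₗ[Gam Λ P] IgusaTodorov.syzygy A) := by
  have hQ := hM.inAdd_coverObj
  have hc := isProjectiveCover_coverMap M
  have hd := isProjectiveCover_coverMap A
  have := hQ.projective_hom
  have := hd.projective
  let e' : (P →ₗ[Λ] M) ≃ₗ[Gam Λ P] A := e
  let π : (P →ₗ[Λ] coverObj M) →ₗ[Gam Λ P] A := e'.toLinearMap ∘ₗ homMap P (coverMap M)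
  have hπ : Function.Surjective π :=
    e.surjective.comp (IgusaTodorov.homMap_surjective hc.surjective)
  obtain ⟨s, hs⟩ := Module.projective_lifting_property (coverMap A) π hd.surjective
  obtain ⟨t, ht⟩ := Module.projective_lifting_property π (coverMap A) hπ
  have hsurj : ∀ {R : Type u} [Ring R] {C X : Type u} [AddCommGroup C] [Module R C]
      [AddCommGroup X] [Module R X] {p : C →ₗ[R] X}, IsProjectiveCover p →
      ∀ a : C →ₗ[R] C, p ∘ₗ a = p → Function.Surjective a := by
    intro R _ C X _ _ _ _ p hp a ha
    rw [← LinearMap.range_eq_top]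
    refine hp.superfluous _ (eq_top_iff.2 fun c _ ↦
      Submodule.mem_sup.2 ⟨_, ⟨c, rfl⟩, c - a c, ?_, by simp⟩)
    have : p (a c) = p c := LinearMap.congr_fun ha c
    simp [this]
  have hst : Function.Surjective (s ∘ₗ t) := hsurj hd _ (by rw [← LinearMap.comp_assoc, hs, ht])
  -- Superfluity of the kernel is known for the cover of `M`, not for its image under `Hom(P, -)`.
  -- So `t ∘ s` is lifted to an endomorphism `a` of the cover over `M`, which is surjective and
  -- hence injective.
  have hts : Function.Injective (t ∘ₗ s) := by
    obtain ⟨a, ha⟩ := hQ.homMap_surjective (t ∘ₗ s)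
    have hca : coverMap M ∘ₗ a = coverMap M := by
      apply hQ.homMap_injective
      rw [homMap_comp, ha]
      refine LinearMap.ext fun x ↦ e.injective ?_
      have h1 := LinearMap.congr_fun ht (s x)
      have h2 := LinearMap.congr_fun hs x
      exact h1.trans h2
    have hinj : Function.Injective a :=
      IsNoetherian.injective_of_surjective_endomorphism a (hsurj hc a hca)
    rw [← ha]
    exact fun x y hxy ↦ (LinearMap.cancel_left hinj).1 hxy
  have hs' : Function.Bijective s :=
    ⟨Function.Injective.of_comp (f := t) hts, Function.Surjective.of_comp (g := t) hst⟩
  let σ := LinearEquiv.ofBijective s hs'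
  refine ⟨homKerEquiv P (coverMap M) ≪≫ₗ σ.ofSubmodules _ _ ?_⟩
  ext y
  obtain ⟨x, rfl⟩ := σ.surjective y
  have h1 : coverMap A (σ x) = e' (homMap P (coverMap M) x) := LinearMap.congr_fun hs x
  rw [Submodule.mem_map_equiv, σ.symm_apply_apply, LinearMap.mem_ker, LinearMap.mem_ker, h1,
    LinearEquiv.map_eq_zero_iff]

theorem IsAddResolved.nonempty_syzygyIter_equiv {M : FGModuleCat.{u} Λ}
    (hM : IsAddResolved (Λ := Λ) P M) {A : FGModuleCat.{u} (Gam Λ P)}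
    (e : evalObj Λ P M ≃ₗ[Gam Λ P] A) (n : ℕ) :
    Nonempty (evalObj Λ P (IgusaTodorov.syzygyIter n M) ≃ₗ[Gam Λ P]
      IgusaTodorov.syzygyIter n A) := by
  induction n generalizing M A with
  | zero => exact ⟨e⟩
  | succ n ih => exact ih hM.syzygy ((hM 2).nonempty_syzygy_equiv e).some

variable (P) in
/-- The subgroup of `K_0(Γ)` generated by the images of the modules resolved by `add P`. -/
def resolvedSpan : AddSubgroup (K0 (Gam Λ P)) :=
  AddSubgroup.closure {x | ∃ M : FGModuleCat.{u} Λ, IsAddResolved (Λ := Λ) P M ∧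
    x = K0.cls (evalObj Λ P M)}

theorem omega_mem_resolvedSpan {x : K0 (Gam Λ P)} (hx : x ∈ resolvedSpan P) :
    omega (Gam Λ P) x ∈ resolvedSpan P := by
  induction hx using AddSubgroup.closure_induction with
  | mem x hx =>
    obtain ⟨M, hM, rfl⟩ := hx
    refine AddSubgroup.subset_closure ⟨syzygy M, hM.syzygy, ?_⟩
    rw [omega_cls]
    exact (K0.cls_congr ((hM 2).nonempty_syzygy_equiv (LinearEquiv.refl _ _)).some).symm
  | zero => simp [zero_mem]
  | add x y _ _ hx hy => rw [map_add]; exact add_mem hx hy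
  | neg x _ hx => rw [map_neg]; exact neg_mem hx

/-- The restriction to `resolvedSpan` matters: for a general `A`, the syzygy of `presentedObj P A`
need not be presented by `add P`. -/
theorem k0Hom_omega {x : K0 (Gam Λ P)} (hx : x ∈ resolvedSpan P) :
    k0Hom P (omega (Gam Λ P) x) = omega Λ (k0Hom P x) := by
  induction hx using AddSubgroup.closure_induction with
  | mem x hx =>
    obtain ⟨M, hM, rfl⟩ := hx
    rw [omega_cls, (hM 2).k0Hom_cls (LinearEquiv.refl _ _), omega_cls,
      (hM.syzygy 2).k0Hom_cls ((hM 2).nonempty_syzygy_equiv (LinearEquiv.refl _ _)).some]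
  | zero => simp
  | add x y _ _ hx hy => simp [hx, hy]
  | neg x _ hx => simp [hx]

theorem IsAddResolved.addSpan_le {Y : FGModuleCat.{u} Λ} (hY : IsAddResolved (Λ := Λ) P Y) :
    addSpan (evalObj Λ P Y) ≤ resolvedSpan P := by
  rw [addSpan, AddSubgroup.closure_le]
  rintro x ⟨A, hA, -, rfl⟩
  refine AddSubgroup.subset_closure ⟨presentedObj P A,
    hY.of_isSummand ((hY 2).presentedObj_isSummand hA), ?_⟩
  exact (K0.cls_congr (evalPresentedEquiv P A)).symm

theorem IsAddResolved.map_addSpan {Y : FGModuleCat.{u} Λ} (hY : IsAddResolved (Λ := Λ) P Y) :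
    (addSpan (evalObj Λ P Y)).map (k0Hom P) = addSpan Y := by
  rw [addSpan, addSpan, AddMonoidHom.map_closure]
  congr 1
  ext x
  constructor
  · rintro ⟨_, ⟨A, hA, hA', rfl⟩, rfl⟩
    refine ⟨presentedObj P A, (hY 2).presentedObj_isSummand hA, ?_, k0Hom_cls A⟩
    rw [(hasAddPresentation_presentedObj P A).isIndecomposable_iff, isIndecomposable_iff_prod]
    rw [isIndecomposable_iff_prod] at hA'
    exact ⟨have := hA'.1; (evalPresentedEquiv P A).toEquiv.nontrivial,
      fun B C _ _ _ _ e ↦ hA'.2 B C ((evalPresentedEquiv P A).symm ≪≫ₗ e)⟩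
  · rintro ⟨X, hX, hX', rfl⟩
    have hX2 := (hY 2).of_isSummand hX
    exact ⟨_, ⟨evalObj Λ P X, hX.hom, hX2.isIndecomposable_iff.1 hX', rfl⟩,
      hX2.k0Hom_cls (LinearEquiv.refl _ _)⟩

theorem IsAddResolved.omegaSpan_le {Y : FGModuleCat.{u} Λ} (hY : IsAddResolved (Λ := Λ) P Y)
    (s : ℕ) : omegaSpan (evalObj Λ P Y) s ≤ resolvedSpan P := by
  induction s with
  | zero => exact hY.addSpan_le
  | succ s ih =>
    rw [omegaSpan, Function.iterate_succ_apply']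
    rintro _ ⟨x, hx, rfl⟩
    exact omega_mem_resolvedSpan (ih hx)

theorem IsAddResolved.map_omegaSpan {Y : FGModuleCat.{u} Λ} (hY : IsAddResolved (Λ := Λ) P Y)
    (s : ℕ) : (omegaSpan (evalObj Λ P Y) s).map (k0Hom P) = omegaSpan Y s := by
  induction s with
  | zero => exact hY.map_addSpan
  | succ s ih =>
    have h1 : omegaSpan Y (s + 1) = (omegaSpan Y s).map (omega Λ) :=
      Function.iterate_succ_apply' _ _ _
    have h2 : omegaSpan (evalObj Λ P Y) (s + 1) =
        (omegaSpan (evalObj Λ P Y) s).map (omega (Gam Λ P)) :=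
      Function.iterate_succ_apply' _ _ _
    rw [h1, h2, ← ih, AddSubgroup.map_map, AddSubgroup.map_map]
    refine SetLike.coe_injective (Set.image_congr fun x hx ↦ ?_)
    exact k0Hom_omega (hY.omegaSpan_le s hx)

/-- Surjectivity is automatic, the target being the image by definition. Only injectivity has to be
compared. -/
theorem bijOn_omegaSpan_iff {Λ : Type u} [Ring Λ] [IsArtinianRing Λ] (M : FGModuleCat.{u} Λ)
    (s : ℕ) : Set.BijOn (omega Λ) (omegaSpan M s) (omegaSpan M (s + 1)) ↔
      Set.InjOn (omega Λ) (omegaSpan M s) := by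
  have h1 : omegaSpan M (s + 1) = (omegaSpan M s).map (omega Λ) :=
    Function.iterate_succ_apply' _ _ _
  rw [h1, AddSubgroup.coe_map]
  exact ⟨Set.BijOn.injOn, Set.InjOn.bijOn_image⟩

/-- `φ_l` of a module resolved by `add P` can be computed over `Γ`. -/
theorem IsAddResolved.phi_eq {Y : FGModuleCat.{u} Λ} (hY : IsAddResolved (Λ := Λ) P Y) :
    phi Y = phi (evalObj Λ P Y) := by
  have key : ∀ s, Set.InjOn (omega Λ) (omegaSpan Y s) ↔
      Set.InjOn (omega (Gam Λ P)) (omegaSpan (evalObj Λ P Y) s) := by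
    intro s
    rw [← hY.map_omegaSpan s, AddSubgroup.coe_map, Set.InjOn, Set.forall_mem_image]
    refine forall₂_congr fun x hx ↦ ?_
    rw [Set.forall_mem_image]
    refine forall₂_congr fun y hy ↦ ?_
    rw [← k0Hom_omega (hY.omegaSpan_le s hx), ← k0Hom_omega (hY.omegaSpan_le s hy),
      k0Hom_injective.eq_iff, k0Hom_injective.eq_iff]
  simp only [phi, bijOn_omegaSpan_iff, key]

end Comparison

/-! ### Exactness of `Hom(P, -)` and the comparison of `Ext` groups. -/

section EvaluationFunctor

variable (Λ : Type u) [Ring Λ] (P : Type u) [AddCommGroup P] [Module Λ P]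

/-- The functor `Hom_Λ(P, -) : Mod Λ ⥤ Mod Γ`. -/
def evalFunctor : ModuleCat.{u} Λ ⥤ ModuleCat.{u} (Gam Λ P) where
  obj M := ModuleCat.of (Gam Λ P) (P →ₗ[Λ] M)
  map f := ModuleCat.ofHom (homMap P f.hom)

instance : (evalFunctor Λ P).Additive where
  map_add := rfl

theorem shortExact_map_evalFunctor [Module.Projective Λ P] (S : ShortComplex (ModuleCat.{u} Λ))
    (hS : S.ShortExact) : (S.map (evalFunctor Λ P)).ShortExact := by
  refine ModuleCat.shortComplex_shortExact _ (fun (b : P →ₗ[Λ] S.X₂) ↦ ⟨fun hb ↦ ?_, ?_⟩) ?_ ?_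
  · have hb' : ∀ x, ∃ y, S.f.hom y = b x := fun x ↦
      (ShortComplex.moduleCat_exact_iff S).1 hS.exact _ (LinearMap.congr_fun hb x)
    obtain ⟨c, hc⟩ := Module.projective_lifting_property S.f.hom.rangeRestrict
      (LinearMap.codRestrict _ b hb') S.f.hom.surjective_rangeRestrict
    exact ⟨c, LinearMap.ext fun x ↦ congrArg Subtype.val (LinearMap.congr_fun hc x)⟩
  · rintro ⟨a, rfl⟩
    exact LinearMap.ext fun x ↦ S.moduleCat_zero_apply _
  · exact fun a b hab ↦ (LinearMap.cancel_left hS.moduleCat_injective_f).1 hab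
  · exact homMap_surjective hS.moduleCat_surjective_g

variable [Module.Projective Λ P]

instance : Limits.PreservesFiniteLimits (evalFunctor Λ P) :=
  (((evalFunctor Λ P).exact_tfae.out 0 3 rfl rfl).1 (shortExact_map_evalFunctor Λ P)).1

instance : Limits.PreservesFiniteColimits (evalFunctor Λ P) :=
  (((evalFunctor Λ P).exact_tfae.out 0 3 rfl rfl).1 (shortExact_map_evalFunctor Λ P)).2

variable {Λ P}

attribute [local simp] Abelian.Ext.mapExactFunctor_comp Abelian.Ext.mapExactFunctor_mk₀
  Abelian.Ext.mapExactFunctor_extClass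

attribute [local instance] Abelian.Ext.subsingleton_of_projective

open Abelian in
/-- `Hom_Λ(P, -)` induces isomorphisms `Ext^d_Λ(X, -) ≃ Ext^d_Γ(Hom_Λ(P, X), Hom_Λ(P, -))` if `X`
has a partial resolution by `add P` of length `d + 2`. -/
theorem HasAddPresentation.bijective_mapExtAddHom {d : ℕ} {X : ModuleCat.{u} Λ}
    (hX : HasAddPresentation (Λ := Λ) P (d + 2) X) (N : ModuleCat.{u} Λ) :
    Function.Bijective ((evalFunctor Λ P).mapExtAddHom X N d) := by
  induction d generalizing X with
  | zero =>
    -- In degree `0` the claim is full faithfulness, which needs two terms of a resolution; each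
    -- dimension shift uses one more, whence `d + 2`.
    have hb : Function.Bijective ((evalFunctor Λ P).map (X := X) (Y := N)) := by
      refine ⟨fun f g hfg ↦ ?_, fun g ↦ ?_⟩
      · exact ModuleCat.hom_ext (hX.of_succ.homMap_injective (congrArg ModuleCat.Hom.hom hfg))
      · obtain ⟨f, hf⟩ := hX.homMap_surjective g.hom
        exact ⟨ModuleCat.ofHom f, ModuleCat.hom_ext hf⟩
    simpa [Ext.mapExactFunctor₀] using hb
  | succ d ih =>
    obtain ⟨Q, _, _, f, hf, hQ, hK⟩ := hX
    let S : ShortComplex (ModuleCat.{u} Λ) := f.shortComplexKer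
    have hS : S.ShortExact := LinearMap.shortExact_shortComplexKer hf
    have hS' := shortExact_map_evalFunctor Λ P S hS
    have hQ₁ : Projective S.X₂ := (IsProjective.iff_projective Q).1 hQ.projective
    have hQ₂ : Projective (S.map (evalFunctor Λ P)).X₂ :=
      (IsProjective.iff_projective (P →ₗ[Λ] Q)).1 hQ.projective_hom
    -- For `0 → K → Q → X → 0`, `Ext^(d+1)(X, N)` is the cokernel of `Ext^d(Q, N) → Ext^d(K, N)`,
    -- because `Ext^(d+1)(Q, N) = 0`. The same holds over `Γ`, where `Hom(P, Q)` is projective, and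
    -- `ih` handles both `Q` and `K`.
    exact AddMonoidHom.bijective_of_surjective_of_bijective_of_right_exact _ _ _ _
      ((evalFunctor Λ P).mapExtAddHom S.X₂ N d) ((evalFunctor Λ P).mapExtAddHom S.X₁ N d)
      ((evalFunctor Λ P).mapExtAddHom S.X₃ N (d + 1))
      (by cat_disch) (by cat_disch)
      ((ShortComplex.ab_exact_iff_function_exact _).1
        (Ext.contravariant_sequence_exact₁' hS N d (d + 1) (add_comm 1 d)))
      ((ShortComplex.ab_exact_iff_function_exact _).1
        (Ext.contravariant_sequence_exact₁' hS' ((evalFunctor Λ P).obj N) d (d + 1)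
          (add_comm 1 d)))
      (ih (hQ.isAddResolved (d + 2))).surjective (ih hK)
      (fun x₃ ↦ Ext.contravariant_sequence_exact₃ hS _ x₃ (by subsingleton) (add_comm 1 d))
      (fun y₃ ↦ Ext.contravariant_sequence_exact₃ hS' _ y₃ (by subsingleton) (add_comm 1 d))

end EvaluationFunctor

/-! ### From projective resolutions to partial resolutions of every length. -/

section Resolutions

variable {Λ : Type u} [Ring Λ] {P : Type u} [AddCommGroup P] [Module Λ P]

theorem HasAddPresentation.ker_of_exact {A B C : Type u} [AddCommGroup A] [Module Λ A]
    [AddCommGroup B] [Module Λ B] [AddCommGroup C] [Module Λ C] {f : A →ₗ[Λ] B} {g : B →ₗ[Λ] C}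
    (hfg : LinearMap.range f = LinearMap.ker g) (hA : InAdd (Λ := Λ) P A) {n : ℕ}
    (h : HasAddPresentation (Λ := Λ) P n (LinearMap.ker f)) :
    HasAddPresentation (Λ := Λ) P (n + 1) (LinearMap.ker g) := by
  refine ⟨A, _, _, f.codRestrict _ fun x ↦ hfg ▸ LinearMap.mem_range_self f x, ?_, hA, ?_⟩
  · rintro ⟨y, hy⟩
    rw [← hfg] at hy
    obtain ⟨x, rfl⟩ := hy
    exact ⟨x, rfl⟩
  · rw [LinearMap.ker_codRestrict]
    exact h

theorem HasAddResolution.isAddResolved {Y : FGModuleCat.{u} Λ} (h : HasAddResolution P Y) :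
    IsAddResolved (Λ := Λ) P Y := by
  obtain ⟨Q, hQ⟩ := h
  -- The kernel of each differential is covered by the term two places further up, so all positions
  -- `i` are treated at once by induction on `n`.
  have hd : ∀ n i, HasAddPresentation (Λ := Λ) P n
      (LinearMap.ker (Q.complex.d (i + 1) i).hom) := by
    intro n
    induction n with
    | zero => exact fun _ ↦ trivial
    | succ n ih =>
      exact fun i ↦ HasAddPresentation.ker_of_exact (Q.exact_succ i).moduleCat_range_eq_ker
        (hQ (i + 2)) (ih (i + 1))
  have hπ : Function.Surjective (Q.π.f 0).hom :=
    (ModuleCat.epi_iff_surjective _).1 inferInstance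
  have hY : ∀ n, HasAddPresentation (Λ := Λ) P n (LinearMap.ker (Q.π.f 0).hom) := by
    rintro (_ | n)
    · trivial
    · exact HasAddPresentation.ker_of_exact Q.exact₀.moduleCat_range_eq_ker (hQ 1) (hd n 0)
  rintro (_ | n)
  · trivial
  · exact ⟨_, _, _, (Q.π.f 0).hom, hπ, hQ 0, hY n⟩

end Resolutions

/-! ### `Ext` functors and `d`-divisions over `Λ` and `Γ`. -/

section ExtComparison

variable {Λ : Type u} [Ring Λ] [IsArtinAlgebra Λ]
  (P : Type u) [AddCommGroup P] [Module Λ P] [Module.Finite Λ P]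

variable (Λ) in
/-- The evaluation functor `Hom_Λ(P, -) : mod Λ ⥤ mod Γ`. -/
def evalFunctorMod : FGModuleCat.{u} Λ ⥤ FGModuleCat.{u} (Gam Λ P) where
  obj := evalObj Λ P
  map f := FGModuleCat.ofHom (homMap P f.hom.hom)

variable [Module.Projective Λ P]

theorem exists_presentedMap {A B : FGModuleCat.{u} (Gam Λ P)} (f : A ⟶ B) :
    ∃ g : presentedObj P A →ₗ[Λ] presentedObj P B, homMap P g =
      (evalPresentedEquiv P B).symm.toLinearMap ∘ₗ f.hom.hom ∘ₗ
        (evalPresentedEquiv P A).toLinearMap :=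
  (hasAddPresentation_presentedObj P A).homMap_surjective _

variable (Λ) in
/-- A section of the evaluation functor. -/
def presentedFunctor : FGModuleCat.{u} (Gam Λ P) ⥤ FGModuleCat.{u} Λ where
  obj := presentedObj P
  map f := FGModuleCat.ofHom (exists_presentedMap P f).choose
  -- Faithfulness of `Hom(P, -)` on presented modules makes the chosen lifts functorial.
  map_id A := by
    refine FGModuleCat.hom_ext ((hasAddPresentation_presentedObj P A).of_succ.homMap_injective ?_)
    refine (exists_presentedMap P (𝟙 A)).choose_spec.trans ?_
    exact LinearMap.ext fun x ↦ (evalPresentedEquiv P A).symm_apply_apply x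
  map_comp {A B C} f g := by
    refine FGModuleCat.hom_ext ((hasAddPresentation_presentedObj P A).of_succ.homMap_injective ?_)
    refine (exists_presentedMap P (f ≫ g)).choose_spec.trans ?_
    have hf := (exists_presentedMap P f).choose_spec
    have hg := (exists_presentedMap P g).choose_spec
    refine Eq.trans ?_ (homMap_comp P _ _).symm
    refine Eq.trans ?_ (congrArg₂ LinearMap.comp hg hf).symm
    refine LinearMap.ext fun x ↦ congrArg (fun y ↦ (evalPresentedEquiv P C).symm (g.hom.hom y)) ?_
    exact ((evalPresentedEquiv P B).apply_symm_apply _).symm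

/-- The section property of `presentedFunctor`. -/
def presentedEvalIso : presentedFunctor Λ P ⋙ evalFunctorMod Λ P ≅ 𝟭 (FGModuleCat.{u} (Gam Λ P)) :=
  NatIso.ofComponents (fun A ↦ LinearEquiv.toFGModuleCatIso (evalPresentedEquiv P A)) <| by
    intro A B f
    refine FGModuleCat.hom_ext (LinearMap.ext fun x ↦ ?_)
    have h := LinearMap.congr_fun (exists_presentedMap P f).choose_spec x
    exact (congrArg (evalPresentedEquiv P B) h).trans (LinearEquiv.apply_symm_apply _ _)

variable {P}

/-- `Ext^d_Λ(X, -) ≃ Ext^d_Γ(Hom_Λ(P, X), Hom_Λ(P, -))` for modules resolved by `add P`. -/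
def HasAddPresentation.extIso {d : ℕ} {X : FGModuleCat.{u} Λ}
    (hX : HasAddPresentation (Λ := Λ) P (d + 2) X) :
    extFunctorMod X d ≅ evalFunctorMod Λ P ⋙ extFunctorMod (evalObj Λ P X) d :=
  NatIso.ofComponents (fun N ↦ AddEquiv.toAddCommGrpIso
    (AddEquiv.ofBijective ((evalFunctor Λ P).mapExtAddHom X.obj N.obj d)
      (hX.bijective_mapExtAddHom N.obj))) <| by
    intro N N' f
    ext α
    have h := Abelian.Ext.mapExactFunctor_comp (evalFunctor Λ P) (α : Abelian.Ext X.obj N.obj d)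
      (Abelian.Ext.mk₀ f.hom) (add_zero d)
    rw [Abelian.Ext.mapExactFunctor_mk₀] at h
    exact h

/-- Both directions are whiskerings: with `evalFunctorMod` from `Γ` to `Λ`, and with its section
`presentedFunctor` from `Λ` to `Γ`. -/
theorem HasAddPresentation.nonempty_ext_iso_iff {d : ℕ} {X X' : FGModuleCat.{u} Λ}
    (hX : HasAddPresentation (Λ := Λ) P (d + 2) X)
    (hX' : HasAddPresentation (Λ := Λ) P (d + 2) X') :
    Nonempty (extFunctorMod X d ≅ extFunctorMod X' d) ↔
      Nonempty (extFunctorMod (evalObj Λ P X) d ≅ extFunctorMod (evalObj Λ P X') d) := by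
  constructor
  · rintro ⟨i⟩
    let j (Z : FGModuleCat.{u} Λ) (hZ : HasAddPresentation (Λ := Λ) P (d + 2) Z) :
        extFunctorMod (evalObj Λ P Z) d ≅ presentedFunctor Λ P ⋙ extFunctorMod Z d :=
      (Functor.leftUnitor _).symm ≪≫ Functor.isoWhiskerRight (presentedEvalIso P).symm _ ≪≫
        Functor.associator _ _ _ ≪≫ Functor.isoWhiskerLeft (presentedFunctor Λ P) hZ.extIso.symm
    exact ⟨j X hX ≪≫ Functor.isoWhiskerLeft _ i ≪≫ (j X' hX').symm⟩
  · rintro ⟨i⟩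
    exact ⟨hX.extIso ≪≫ Functor.isoWhiskerLeft _ i ≪≫ hX'.extIso.symm⟩

/-- `Ext^d(X, -)` depends only on the isomorphism class of `X`. -/
def extFunctorModIso {Λ : Type u} [Ring Λ] {X Y : FGModuleCat.{u} Λ} (e : X ≃ₗ[Λ] Y) (d : ℕ) :
    extFunctorMod X d ≅ extFunctorMod Y d :=
  Functor.isoWhiskerLeft _
    ((Abelian.extFunctor d).mapIso (LinearEquiv.toModuleIso e).symm.op)

theorem IsDivision.of_equiv {Λ : Type u} [Ring Λ] {d : ℕ} {M X Y X' Y' : FGModuleCat.{u} Λ}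
    (h : IsDivision d M X Y) (e : X ≃ₗ[Λ] X') (e' : Y ≃ₗ[Λ] Y') : IsDivision d M X' Y' where
  left_mem := h.left_mem.of_isSummand (.of_equiv e.symm)
  right_mem := h.right_mem.of_isSummand (.of_equiv e'.symm)
  add_inter Z hZ hZ' := by
    refine h.add_inter Z ?_ ?_
    · exact hZ.trans ((InAdd.self _).of_isSummand (.of_equiv e.symm))
    · exact hZ'.trans ((InAdd.self _).of_isSummand (.of_equiv e'.symm))
  not_iso := fun ⟨i⟩ ↦ h.not_iso
    ⟨extFunctorModIso e d ≪≫ i ≪≫ (extFunctorModIso e' d).symm⟩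
  iso_succ := h.iso_succ.map fun i ↦
    (extFunctorModIso e (d + 1)).symm ≪≫ i ≪≫ extFunctorModIso e' (d + 1)

/-- Two-term presentations of `X` and `Y` suffice as hypotheses: either side forces `X` and `Y` into
`add M`, which makes them resolved to any length. -/
theorem IsAddResolved.isDivision_iff {d : ℕ} {M X Y : FGModuleCat.{u} Λ}
    (hM : IsAddResolved (Λ := Λ) P M) (hX : HasAddPresentation (Λ := Λ) P 2 X)
    (hY : HasAddPresentation (Λ := Λ) P 2 Y) :
    IsDivision d M X Y ↔ IsDivision d (evalObj Λ P M) (evalObj Λ P X) (evalObj Λ P Y) := by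
  constructor
  · intro h
    have hX' := hM.of_inAdd h.left_mem
    have hY' := hM.of_inAdd h.right_mem
    refine ⟨h.left_mem.hom, h.right_mem.hom, fun Z hZ hZ' ↦ ?_,
      ((hX' (d + 2)).nonempty_ext_iso_iff (hY' (d + 2))).not.1 h.not_iso,
      ((hX' (d + 3)).nonempty_ext_iso_iff (hY' (d + 3))).1 h.iso_succ⟩
    have h0 := h.add_inter (presentedObj P Z) (hX.presentedObj_inAdd hZ)
      (hY.presentedObj_inAdd hZ')
    exact ⟨fun a b ↦ (evalPresentedEquiv P Z).symm.injective
      (LinearMap.ext fun x ↦ h0.elim _ _)⟩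
  · intro h
    have h1 := hX.inAdd_of_hom (hM 2) h.left_mem
    have h2 := hY.inAdd_of_hom (hM 2) h.right_mem
    have hX' := hM.of_inAdd h1
    have hY' := hM.of_inAdd h2
    refine ⟨h1, h2, fun Z hZ hZ' ↦ (hX'.of_inAdd hZ 1).subsingleton_of_hom ?_,
      ((hX' (d + 2)).nonempty_ext_iso_iff (hY' (d + 2))).not.2 h.not_iso,
      ((hX' (d + 3)).nonempty_ext_iso_iff (hY' (d + 3))).2 h.iso_succ⟩
    exact h.add_inter (evalObj Λ P Z) hZ.hom hZ'.hom

theorem IsAddResolved.hasDivision_iff {M : FGModuleCat.{u} Λ}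
    (hM : IsAddResolved (Λ := Λ) P M) (d : ℕ) :
    HasDivision d M ↔ HasDivision d (evalObj Λ P M) := by
  constructor
  · rintro ⟨X, Y, h⟩
    exact ⟨_, _, (hM.isDivision_iff (hM.of_inAdd h.left_mem 2)
      (hM.of_inAdd h.right_mem 2)).1 h⟩
  · rintro ⟨A, B, h⟩
    refine ⟨_, _, (hM.isDivision_iff (hasAddPresentation_presentedObj P A)
      (hasAddPresentation_presentedObj P B)).2
      (h.of_equiv (evalPresentedEquiv P A).symm (evalPresentedEquiv P B).symm)⟩

end ExtComparison

/-! ### Projective dimension and `ψ_l`. -/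

section ProjectiveDimension

variable {Λ : Type u} [Ring Λ] [IsArtinAlgebra Λ]
  {P : Type u} [AddCommGroup P] [Module Λ P] [Module.Finite Λ P] [Module.Projective Λ P]

/-- Projective covers shift the dimension on both sides, and the syzygy of `X` is again resolved.
The shift starts only above projectivity, so the zero and the projective case are separate. -/
theorem IsAddResolved.hasProjectiveDimensionLT_iff {X : FGModuleCat.{u} Λ}
    (hX : IsAddResolved (Λ := Λ) P X) (n : ℕ) :
    HasProjectiveDimensionLT X.obj n ↔ HasProjectiveDimensionLT (evalObj Λ P X).obj n := by
  induction n generalizing X with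
  | zero =>
    rw [hasProjectiveDimensionLT_zero_iff_isZero, hasProjectiveDimensionLT_zero_iff_isZero,
      ModuleCat.isZero_iff_subsingleton, ModuleCat.isZero_iff_subsingleton]
    exact ⟨fun h ↦ ⟨fun a b ↦ LinearMap.ext fun x ↦ h.elim _ _⟩, (hX 1).subsingleton_of_hom⟩
  | succ n ih =>
    cases n with
    | zero =>
      rw [zero_add, ← projective_iff_hasProjectiveDimensionLT_one,
        ← projective_iff_hasProjectiveDimensionLT_one]
      exact (IsProjective.iff_projective X).symm.trans
        ((hX 2).projective_iff.trans (IsProjective.iff_projective (evalObj Λ P X)))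
    | succ n =>
      have hc := isProjectiveCover_coverMap X
      have hQ := (hX 1).inAdd_coverObj
      have hS := LinearMap.shortExact_shortComplexKer hc.surjective
      have hS' := shortExact_map_evalFunctor Λ P _ hS
      have h1 := hS.hasProjectiveDimensionLT_X₃_iff n
        ((IsProjective.iff_projective (coverObj X)).1 hc.projective)
      have h2 := hS'.hasProjectiveDimensionLT_X₃_iff n
        ((IsProjective.iff_projective (P →ₗ[Λ] coverObj X)).1 hQ.projective_hom)
      exact h1.trans ((ih hX.syzygy).trans h2.symm)

theorem IsAddResolved.projectiveDimension_eq {X : FGModuleCat.{u} Λ}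
    (hX : IsAddResolved (Λ := Λ) P X) :
    projectiveDimension X.obj = projectiveDimension (evalObj Λ P X).obj := by
  simp only [projectiveDimension, hX.hasProjectiveDimensionLT_iff]

/-- `ψ_l` of a module resolved by `add P` can be computed over `Γ`. -/
theorem IsAddResolved.psi_eq {Y : FGModuleCat.{u} Λ} (hY : IsAddResolved (Λ := Λ) P Y) :
    psi Y = psi (evalObj Λ P Y) := by
  rw [psi, psi, ← hY.phi_eq]
  congr 2
  have hΩ := hY.syzygyIter (phi Y)
  -- Since the two values of `φ_l` agree, the same iterate of `Ω` occurs on both sides, and summands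
  -- can be matched through `e`.
  obtain ⟨e⟩ := hY.nonempty_syzygyIter_equiv (LinearEquiv.refl _ (evalObj Λ P Y)) (phi Y)
  ext m
  constructor
  · rintro ⟨X, n, hX, hn, rfl⟩
    exact ⟨evalObj Λ P X, n, hX.hom.trans (.of_equiv e),
      (hΩ.of_isSummand hX).projectiveDimension_eq.symm.trans hn, rfl⟩
  · rintro ⟨A, n, hA, hn, rfl⟩
    have hs := (hΩ 2).presentedObj_isSummand (hA.trans (.of_equiv e.symm))
    refine ⟨presentedObj P A, n, hs, ?_, rfl⟩
    rw [(hΩ.of_isSummand hs).projectiveDimension_eq, ← hn]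
    exact projectiveDimension_eq_of_iso (LinearEquiv.toModuleIso (evalPresentedEquiv P A))

end ProjectiveDimension

end

end IgusaTodorov

theorem proposition4p5 {Λ : Type u} [Ring Λ] [IgusaTodorov.IsArtinAlgebra Λ]
    (P : Type u) [AddCommGroup P] [Module Λ P] [Module.Finite Λ P] [Module.Projective Λ P]
    (Y : FGModuleCat.{u} Λ) (hY : IgusaTodorov.HasAddResolution P Y) :
    (∀ d : ℕ, IgusaTodorov.HasDivision d Y ↔
      IgusaTodorov.HasDivision d (IgusaTodorov.evalObj Λ P Y)) ∧
    IgusaTodorov.phi Y = IgusaTodorov.phi (IgusaTodorov.evalObj Λ P Y) ∧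
    IgusaTodorov.psi Y = IgusaTodorov.psi (IgusaTodorov.evalObj Λ P Y) := by
  have h := hY.isAddResolved
  exact ⟨h.hasDivision_iff, h.phi_eq, h.psi_eq⟩
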